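/- Let $p$ be an odd prime and let $G$ be a finite group of order $16p$ whose Sylow $p$-subgroup is normal. Let $G' = [G,G]$ be the commutator subgroup of $G$, and assume $G/G' \cong \mathbb{Z}_2 \times \mathbb{Z}_2$. Let $S$ be a minimal generating set of $G$ (that is, $S$ generates $G$ but no proper subset of $S$ does). Then the Cayley graph $\mathrm{Cay}(G;S)$, i.e. the graph with vertex set $G$ in which distinct vertices $u, v$ are adjacent if and only if $u^{-1}v \in S \cup S^{-1}$, has a hamiltonian cycle. -/

import Mathlib

/-! Let `N` be the normal subgroup of order `p` and `f` the map onto the Klein four-group `G/G'`.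
Then `N ≤ G'`, every element of `G` centralises or inverts `N`, and `G/N` has order 16 with derived
subgroup of order 4. That derived subgroup is cyclic, generated by `⁅a, b⁆` whenever `f a`, `f b`
generate the Klein group (`orderOf_commutatorElement_eq_four`).

Pick such `a, b ∈ S`. If they generate `G`, then `⁅a, b⁆` generates `G'`, and repeating the word `a
b a⁻¹ b⁻¹` is a hamiltonian cycle by the factor group lemma.

Otherwise `⟨a, b⟩` is a complement of `N`, and some `c ∈ S` outside it is `q * w` with `q ∈ ⟨a, b⟩`
and `1 ≠ w ∈ N`. Minimality of `S` makes `⟨b, c⟩` or `⟨a, c⟩` proper when its image is the whole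
Klein group, which restricts the action on `w`: up to exchanging `a` and `b`, either `c = u ^ t *
w`, or `c = a * u ^ t * w` with `b` centralising and `a` inverting `w`, where `u = ⁅a, b⁆`. If `c =
w`, an explicit cycle works for all `p`. In the other cases the group law modulo `p` depends on
finitely many constants. A finite computation supplies words of length 16 through all cosets of
`⟨w⟩` ending at `w ^ K`, with `p ∤ K` except for `p = 7` and `p = 3` in some cases, where full
cycles are given. -/

/-! ### Hamiltonian cycles from words; the factor group lemma. -/

theorem List.exists_mulCayley_isHamiltonianCycle {G : Type*} [Group G] [Finite G] [DecidableEq G]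
    {S : Set G} {M : List G} (hS : ∀ s ∈ M, s ∈ S ∨ s⁻¹ ∈ S) (hlen : M.length = Nat.card G)
    (h3 : 3 ≤ M.length) (hprod : M.prod = 1) (hcov : ∀ g, ∃ i < M.length, (M.take i).prod = g) :
    ∃ (g : G) (c : (SimpleGraph.mulCayley S).Walk g g), c.IsHamiltonianCycle := by
  obtain ⟨n, hn⟩ : ∃ n, M.length = n + 3 := ⟨M.length - 3, by omega⟩
  have := Fintype.ofFinite G
  let f : Fin (n + 3) → G := fun i ↦ (M.take i).prod
  have hsurj : Function.Surjective f := fun g ↦ by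
    obtain ⟨i, hi, h⟩ := hcov g
    exact ⟨⟨i, by omega⟩, h⟩
  have hbij : Function.Bijective f := by
    refine (Fintype.bijective_iff_surjective_and_card f).2 ⟨hsurj, ?_⟩
    rw [Fintype.card_fin, ← hn, hlen, Nat.card_eq_fintype_card]
  have hstep : ∀ i : Fin (n + 3), ∃ s ∈ M, f (i + 1) = f i * s := by
    intro i
    have hi : (i : ℕ) < M.length := by omega
    refine ⟨M[(i : ℕ)], List.getElem_mem _, ?_⟩
    have key : (M.take ((i : ℕ) + 1)).prod = f i * M[(i : ℕ)] := by
      rw [List.prod_take_succ _ _ hi]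
    rw [← key]
    -- At the last index `i + 1` wraps around to `0`, and the edge closes up because the whole
    -- product is `1`.
    by_cases hl : i = Fin.last (n + 2)
    · subst hl
      simp only [Fin.last_add_one, Fin.val_last, f]
      rw [List.take_of_length_le (i := n + 2 + 1) (by omega), hprod]
      simp
    · have : ((i + 1 : Fin (n + 3)) : ℕ) = i + 1 := by
        rw [Fin.val_add_one, if_neg hl]
      simp [f, this]
  have hadj : ∀ i : Fin (n + 3), (SimpleGraph.mulCayley S).Adj (f i) (f (i + 1)) := by
    intro i
    rw [SimpleGraph.mulCayley_adj']
    refine ⟨fun h ↦ ?_, ?_⟩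
    · have := hbij.1 h
      simp at this
    · obtain ⟨s, hs, he⟩ := hstep i
      rcases hS s hs with h | h
      · exact ⟨s, h, Or.inl he.symm⟩
      · exact ⟨s⁻¹, h, Or.inr (by rw [he]; group)⟩
  let φ : SimpleGraph.cycleGraph (n + 3) →g SimpleGraph.mulCayley S :=
    { toFun := f
      map_rel' := by
        intro u v huv
        rw [SimpleGraph.cycleGraph_adj] at huv
        rcases huv with h | h
        · rw [sub_eq_iff_eq_add'] at h
          rw [h, add_comm]
          exact add_comm v 1 ▸ (hadj v).symm
        · rw [sub_eq_iff_eq_add'] at h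
          rw [h, add_comm]
          exact add_comm u 1 ▸ (hadj u) }
  refine ⟨_, (SimpleGraph.cycleGraph.cycle n).map φ, SimpleGraph.Walk.IsHamiltonianCycle.map hbij ?_⟩
  rw [SimpleGraph.Walk.isHamiltonianCycle_iff_isCycle_and_length_eq]
  exact ⟨SimpleGraph.cycleGraph.isCycle_cycle, by simp⟩

theorem List.take_flatten_replicate {α : Type*} (L : List α) {n m i : ℕ} (hm : m < n)
    (hi : i ≤ L.length) :
    ((List.replicate n L).flatten).take (m * L.length + i) =
      (List.replicate m L).flatten ++ L.take i := by
  obtain ⟨k, rfl⟩ : ∃ k, n = m + (k + 1) := ⟨n - m - 1, by omega⟩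
  rw [← List.replicate_append_replicate, List.flatten_append, List.take_append]
  have hl : (List.replicate m L).flatten.length = m * L.length := by simp
  rw [hl, List.take_of_length_le (by rw [hl]; omega), Nat.add_sub_cancel_left,
    List.replicate_succ, List.flatten_cons, List.take_append, Nat.sub_eq_zero_of_le hi]
  simp

theorem List.prod_flatten_replicate {G : Type*} [Monoid G] (L : List G) (m : ℕ) :
    ((List.replicate m L).flatten).prod = L.prod ^ m := by
  induction m with
  | zero => simp
  | succ m ih => rw [List.replicate_succ, List.flatten_cons, List.prod_append, ih, pow_succ']

/-- The factor group lemma: a walk whose endpoint `x` generates a subgroup for which the walk is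
a system of coset representatives closes up to a hamiltonian cycle. -/
theorem List.exists_mulCayley_isHamiltonianCycle_of_coset {G : Type*} [Group G] [Finite G]
    [DecidableEq G] {S : Set G} {L : List G} (hS : ∀ s ∈ L, s ∈ S ∨ s⁻¹ ∈ S)
    (hlen : orderOf L.prod * L.length = Nat.card G) (h3 : 3 ≤ Nat.card G)
    (hcov : ∀ g, ∃ m : ℤ, ∃ i < L.length, g = L.prod ^ m * (L.take i).prod) :
    ∃ (g : G) (c : (SimpleGraph.mulCayley S).Walk g g), c.IsHamiltonianCycle := by
  have hl : ((List.replicate (orderOf L.prod) L).flatten).length = Nat.card G := by simp [hlen]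
  refine List.exists_mulCayley_isHamiltonianCycle
    (M := (List.replicate (orderOf L.prod) L).flatten) ?_ hl (hl ▸ h3) ?_ ?_
  · intro s hs
    simp only [List.mem_flatten, List.mem_replicate] at hs
    obtain ⟨l, ⟨-, rfl⟩, hs⟩ := hs
    exact hS s hs
  · rw [List.prod_flatten_replicate, pow_orderOf_eq_one]
  · intro g
    obtain ⟨m, i, hi, rfl⟩ := hcov g
    obtain ⟨k, hk, hk'⟩ : ∃ k < orderOf L.prod, L.prod ^ m = L.prod ^ k := by
      have hpos := orderOf_pos L.prod
      refine ⟨(m % (orderOf L.prod : ℤ)).toNat, ?_, ?_⟩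
      · have := Int.emod_lt_of_pos m (Int.natCast_pos.2 hpos)
        have := Int.emod_nonneg m (Int.natCast_pos.2 hpos).ne'
        omega
      · rw [← zpow_natCast, Int.toNat_of_nonneg
          (Int.emod_nonneg m (Int.natCast_pos.2 hpos).ne'), zpow_mod_orderOf]
    refine ⟨k * L.length + i, ?_, ?_⟩
    · rw [hl, ← hlen]
      calc k * L.length + i < k * L.length + L.length := by omega
        _ = (k + 1) * L.length := by ring
        _ ≤ _ := Nat.mul_le_mul_right _ hk
    · rw [List.take_flatten_replicate L hk hi.le, List.prod_append, List.prod_flatten_replicate,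
        hk']

/-! ### Symbolic arithmetic of normal forms and the finite word search. -/

/-- The generators `a`, `b`, `c` and their inverses `A`, `B`, `C`. -/
inductive Letter
  | a | A | b | B | c | C

/-- The element denoted by a letter. -/
def Letter.val {G : Type*} [Group G] (a b c : G) : Letter → G
  | .a => a | .A => a⁻¹ | .b => b | .B => b⁻¹ | .c => c | .C => c⁻¹

/-- The vector `(l, i, j, k)` represents the normal form `w ^ l * u ^ i * a ^ j * b ^ k`. -/
structure NormalForm where
  l : ℤ
  i : ℤ
  j : Bool
  k : Bool

/-- Structure constants of a group generated by `a`, `b` and a central-by-sign element `w`, with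
`u = ⁅a, b⁆` of order four, `a ^ 2 = u ^ α`, `b ^ 2 = u ^ β`; the flags `sa`, `sb` record whether
`a`, `b` invert `u`, and `ca`, `cb` whether they invert `w`. The third generator is
`c = a ^ e * u ^ t * w`. -/
structure Params where
  sa : Bool
  sb : Bool
  ca : Bool
  cb : Bool
  e : Bool
  α : Fin 4
  β : Fin 4
  t : Fin 4

/-- The sign by which the power of an element acts, `s` telling whether the element inverts and
`j` whether it occurs. -/
def sgn (s j : Bool) : ℤ := if s && j then -1 else 1

namespace Params

variable (κ : Params)

/-- Right multiplication of a normal form by `u ^ m`. -/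
def mulU (m : ℤ) (x : NormalForm) : NormalForm :=
  { x with i := x.i + sgn κ.sa x.j * (sgn κ.sb x.k * m) }

/-- Right multiplication of a normal form by `w ^ m`. -/
def mulW (m : ℤ) (x : NormalForm) : NormalForm :=
  { x with l := x.l + sgn κ.ca x.j * (sgn κ.cb x.k * m) }

/-- Right multiplication of a normal form by `b`. -/
def mulB (x : NormalForm) : NormalForm :=
  { x with i := x.i + (if x.k then sgn κ.sa x.j * (κ.β : ℤ) else 0), k := !x.k }

/-- Right multiplication of a normal form by `a`. -/
def mulA (x : NormalForm) : NormalForm :=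
  -- Moving `a` to the left of `b` costs `u⁻¹`, as `b * a = u⁻¹ * a * b`; passing `a ^ j` then gives
  -- that exponent its sign. A resulting `a * a` contributes `u ^ α`.
  { x with i := x.i + (if x.k then - sgn κ.sa x.j else 0) + (if x.j then (κ.α : ℤ) else 0),
           j := !x.j }

/-- Right multiplication of a normal form by `a⁻¹`. -/
def mulAinv (x : NormalForm) : NormalForm := κ.mulA (κ.mulU (-(κ.α : ℤ)) x)

/-- Right multiplication of a normal form by `b⁻¹`. -/
def mulBinv (x : NormalForm) : NormalForm := κ.mulB (κ.mulU (-(κ.β : ℤ)) x)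

/-- Right multiplication of a normal form by a letter. -/
def step (x : NormalForm) : Letter → NormalForm
  | .a => κ.mulA x
  | .A => κ.mulAinv x
  | .b => κ.mulB x
  | .B => κ.mulBinv x
  | .c => κ.mulW 1 (κ.mulU κ.t (if κ.e then κ.mulA x else x))
  | .C => if κ.e then κ.mulAinv (κ.mulU (-(κ.t : ℤ)) (κ.mulW (-1) x))
      else κ.mulU (-(κ.t : ℤ)) (κ.mulW (-1) x)

/-- A numerical code for the normal form modulo `u ^ 4` and `w ^ q`. -/
def _root_.NormalForm.code (q : ℕ) (x : NormalForm) : ℕ :=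
  ((x.l % q).toNat * 4 + (x.i % 4).toNat) * 4 + (x.j.toNat * 2 + x.k.toNat)

/-- The codes of the proper prefixes of a word, read from a given normal form. -/
def codes (q : ℕ) (x : NormalForm) : List Letter → List ℕ
  | [] => []
  | s :: L => x.code q :: codes q (κ.step x s) L

/-- The normal form of a word. -/
def final (L : List Letter) : NormalForm := L.foldl κ.step ⟨0, 0, false, false⟩

/-- The word `L` visits each normal form modulo `u ^ 4` and `w ^ q` once and returns to
a power of `w`. -/
def check (q : ℕ) (L : List Letter) : Bool :=
  -- Modulus 1 forgets the exponent of `w`, so the word may end at any power of `w`. As there are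
  -- only `16 * q` prefixes, covering all codes means meeting each once.
  L.length == 16 * q && ((κ.final L).code 1 == 0 &&
    (List.range (16 * q)).all fun n ↦ (κ.codes q ⟨0, 0, false, false⟩ L).contains n)

/-- Compatibility of the structure constants with the group axioms, and the conditions on the
third generator. -/
def admissible : Bool :=
  -- The four congruences say that `a` commutes with `a ^ 2`, that `b` commutes with `b ^ 2`, and
  -- that squaring `a * b * a⁻¹ = u * b` and `b * a * b⁻¹ = u⁻¹ * a` is consistent.
  (sgn κ.sa true * κ.α - κ.α) % 4 == 0 && ((sgn κ.sb true * κ.β - κ.β) % 4 == 0 &&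
  ((sgn κ.sa true * κ.β - (1 + sgn κ.sb true + κ.β)) % 4 == 0 &&
  ((sgn κ.sb true * κ.α - (κ.α - 1 - sgn κ.sa true)) % 4 == 0 &&
  (if κ.e then κ.ca && !κ.cb else (κ.ca || κ.cb) && κ.t != 0))))

/-- Closed walks for the third generator; each of them works for several structure constants. -/
def words : List (List Letter) :=
  [[.c, .B, .a, .B, .C, .b, .A, .b, .c, .B, .a, .B, .C, .b, .A, .b],
   [.b, .C, .B, .a, .b, .A, .B, .a, .b, .c, .B, .A, .b, .a, .B, .A],
   [.a, .b, .C, .B, .c, .b, .C, .B, .A, .C, .C, .b, .C, .C, .C, .B],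
   [.B, .A, .b, .c, .B, .A, .b, .c, .B, .A, .b, .c, .B, .A, .b, .c],
   [.C, .b, .A, .b, .C, .b, .A, .b, .C, .b, .A, .b, .C, .b, .A, .b],
   [.C, .A, .B, .a, .b, .A, .B, .a, .c, .A, .b, .a, .B, .A, .b, .a],
   [.C, .a, .c, .A, .C, .A, .B, .a, .c, .A, .C, .A, .c, .a, .b, .a],
   [.a, .b, .c, .B, .A, .b, .c, .c, .c, .B, .a, .b, .c, .B, .A, .c],
   [.c, .B, .c, .a, .b, .c, .A, .A, .C, .A, .b, .a, .c, .a, .c, .B],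
   [.b, .A, .b, .A, .c, .A, .b, .C, .a, .a, .B, .C, .B, .C, .B, .c],
   [.c, .b, .A, .C, .B, .B, .A, .B, .A, .C, .A, .c, .b, .C, .a, .B],
   [.A, .c, .b, .b, .b, .C, .B, .B, .B, .c, .b, .C, .B, .B, .c, .B]]

/-- Some word returns to `w ^ K` with `K` prime to all odd primes, or to all odd primes except
`7` or `3`, with a further word for that prime. -/
def solved : Bool :=
  (words.any fun L ↦ κ.check 1 L && [1, 2, 4, 8, 16].contains (κ.final L).l.natAbs) ||
  -- Here `K = ±7`, so `p = 7` needs its own word: `L'` has length `8 * 14 = 16 * 7` and is a whole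
  -- hamiltonian cycle. Below, `8 * 6 = 16 * 3` plays this role for `p = 3`.
  (let L := [.b, .a, .c, .a, .c, .a, .c, .a, .b, .c, .a, .c, .a, .c, .a, .c]
   let L' := (List.replicate 8 [.a, .c, .a, .c, .a, .c, .a, .b, .a, .c, .a, .c, .a, .c]).flatten
   κ.check 1 L && ((κ.final L).l.natAbs == 7 && (κ.check 7 L' && (κ.final L').l % 7 == 0))) ||
  (let L := [.b, .a, .c, .a, .b, .c, .a, .c, .b, .a, .c, .a, .b, .c, .a, .c]
   let L' := (List.replicate 8 [.a, .c, .a, .b, .a, .c]).flatten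
   κ.check 1 L && ((κ.final L).l.natAbs == 6 && (κ.check 3 L' && (κ.final L').l % 3 == 0)))

/-- Exhaustion over `2 ^ 5 * 4 ^ 3` tuples. The prime does not enter: exponents of `w` are kept as
integers, so one check serves all `p`. -/
theorem solved_of_admissible : ∀ κ : Params, κ.admissible = true → κ.solved = true := by
  have h : ∀ sa sb ca cb e : Bool, ∀ α β t : Fin 4,
      (!admissible ⟨sa, sb, ca, cb, e, α, β, t⟩ || solved ⟨sa, sb, ca, cb, e, α, β, t⟩) = true := by
    decide +kernel
  rintro ⟨sa, sb, ca, cb, e, α, β, t⟩ hκ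
  simpa [hκ] using h sa sb ca cb e α β t

end Params

/-! ### Soundness of the symbolic arithmetic in an actual group. -/

/-- The elements `a`, `b`, `u`, `w` of a group satisfy the relations encoded by `κ`. -/
structure Params.Realizes {G : Type*} [Group G] (κ : Params) (a b u w : G) : Prop where
  orderOf_u : orderOf u = 4
  comm : a * b = u * b * a
  a_u : a * u * a⁻¹ = u ^ sgn κ.sa true
  b_u : b * u * b⁻¹ = u ^ sgn κ.sb true
  a_w : a * w * a⁻¹ = w ^ sgn κ.ca true
  b_w : b * w * b⁻¹ = w ^ sgn κ.cb true
  u_w : Commute u w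
  a_sq : a * a = u ^ (κ.α : ℤ)
  b_sq : b * b = u ^ (κ.β : ℤ)

/-- The element represented by a normal form. -/
def NormalForm.eval {G : Type*} [Group G] (a b u w : G) (x : NormalForm) : G :=
  w ^ x.l * u ^ x.i * ((if x.j then a else 1) * if x.k then b else 1)

/-- The third generator. -/
def Params.third {G : Type*} [Group G] (κ : Params) (a u w : G) : G :=
  (if κ.e then a else 1) * u ^ (κ.t : ℤ) * w

theorem mul_zpow_eq_of_conj {G : Type*} [Group G] {a u : G} {s : Bool}
    (h : a * u * a⁻¹ = u ^ sgn s true) (j : Bool) (m : ℤ) :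
    (if j then a else 1) * u ^ m = u ^ (sgn s j * m) * (if j then a else 1) := by
  cases j
  · simp [sgn]
  · have : (a * u * a⁻¹) ^ m = a * u ^ m * a⁻¹ := conj_zpow
    rw [h, ← zpow_mul] at this
    simp [this]

namespace Params.Realizes

variable {G : Type*} [Group G] {κ : Params} {a b u w : G}

theorem eval_mulU (h : κ.Realizes a b u w) (m : ℤ) (x : NormalForm) :
    (κ.mulU m x).eval a b u w = x.eval a b u w * u ^ m := by
  obtain ⟨l, i, j, k⟩ := x
  change w ^ l * u ^ (i + sgn κ.sa j * (sgn κ.sb k * m)) *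
    ((if j then a else 1) * if k then b else 1) = w ^ l * u ^ i *
    ((if j then a else 1) * if k then b else 1) * u ^ m
  rw [mul_assoc (w ^ l * u ^ i), mul_assoc (if j then a else 1), mul_zpow_eq_of_conj h.b_u,
    ← mul_assoc _ (u ^ _) (if k then b else 1), mul_zpow_eq_of_conj h.a_u, zpow_add]
  simp only [mul_assoc]

theorem eval_mulW (h : κ.Realizes a b u w) (m : ℤ) (x : NormalForm) :
    (κ.mulW m x).eval a b u w = x.eval a b u w * w ^ m := by
  obtain ⟨l, i, j, k⟩ := x
  change w ^ (l + sgn κ.ca j * (sgn κ.cb k * m)) * u ^ i *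
    ((if j then a else 1) * if k then b else 1) = w ^ l * u ^ i *
    ((if j then a else 1) * if k then b else 1) * w ^ m
  rw [mul_assoc (w ^ l * u ^ i), mul_assoc (if j then a else 1), mul_zpow_eq_of_conj h.b_w,
    ← mul_assoc _ (w ^ _) (if k then b else 1), mul_zpow_eq_of_conj h.a_w, zpow_add]
  have (m n : ℤ) : u ^ m * w ^ n = w ^ n * u ^ m := (h.u_w.zpow_zpow m n).eq
  simp only [mul_assoc]
  congr 1
  rw [← mul_assoc, ← this, mul_assoc]

theorem eval_mulB (h : κ.Realizes a b u w) (x : NormalForm) :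
    (κ.mulB x).eval a b u w = x.eval a b u w * b := by
  obtain ⟨l, i, j, k⟩ := x
  cases k
  · simp [NormalForm.eval, mulB, mul_assoc]
  · change w ^ l * u ^ (i + sgn κ.sa j * (κ.β : ℤ)) * ((if j then a else 1) * 1) =
      w ^ l * u ^ i * ((if j then a else 1) * b) * b
    rw [mul_one, mul_assoc (w ^ l * u ^ i), mul_assoc _ b b, h.b_sq, mul_zpow_eq_of_conj h.a_u,
      zpow_add]
    simp only [mul_assoc]

theorem b_mul_a (h : κ.Realizes a b u w) : b * a = u ^ (-1 : ℤ) * (a * b) := by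
  rw [h.comm]; group

theorem eval_mulA (h : κ.Realizes a b u w) (x : NormalForm) :
    (κ.mulA x).eval a b u w = x.eval a b u w * a := by
  obtain ⟨l, i, j, k⟩ := x
  have key : (if j then a else 1) * a = u ^ (if j then (κ.α : ℤ) else 0) * if !j then a else 1 := by
    cases j <;> simp [h.a_sq]
  cases k
  · simp only [NormalForm.eval, mulA, mul_assoc]
    simp [key, zpow_add, mul_assoc]
  · simp only [NormalForm.eval, mulA, mul_assoc, if_true]
    rw [h.b_mul_a, ← mul_assoc _ (u ^ _) (a * b), mul_zpow_eq_of_conj h.a_u, mul_assoc,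
      ← mul_assoc _ a b, key]
    simp [zpow_add, mul_assoc]

theorem eval_mulAinv (h : κ.Realizes a b u w) (x : NormalForm) :
    (κ.mulAinv x).eval a b u w = x.eval a b u w * a⁻¹ := by
  rw [mulAinv, h.eval_mulA, h.eval_mulU, zpow_neg, ← h.a_sq]; group

theorem eval_mulBinv (h : κ.Realizes a b u w) (x : NormalForm) :
    (κ.mulBinv x).eval a b u w = x.eval a b u w * b⁻¹ := by
  rw [mulBinv, h.eval_mulB, h.eval_mulU, zpow_neg, ← h.b_sq]; group

theorem eval_step (h : κ.Realizes a b u w) (x : NormalForm) (s : Letter) :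
    (κ.step x s).eval a b u w = x.eval a b u w * s.val a b (κ.third a u w) := by
  cases s
  case a => exact h.eval_mulA x
  case A => exact h.eval_mulAinv x
  case b => exact h.eval_mulB x
  case B => exact h.eval_mulBinv x
  case c =>
    simp only [step, Letter.val, third]
    rw [h.eval_mulW, h.eval_mulU]
    cases κ.e <;> simp [h.eval_mulA, mul_assoc]
  case C =>
    simp only [step, Letter.val, third]
    cases κ.e <;>
      simp [h.eval_mulAinv, h.eval_mulU, h.eval_mulW, mul_assoc]

theorem eval_foldl (h : κ.Realizes a b u w) (L : List Letter) (x : NormalForm) :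
    (L.foldl κ.step x).eval a b u w =
      x.eval a b u w * (L.map (Letter.val a b (κ.third a u w))).prod := by
  induction L generalizing x with
  | nil => simp
  | cons s L ih => simp [ih, h.eval_step, mul_assoc]

theorem exists_eval (h : κ.Realizes a b u w)
    (hgen : Subgroup.closure {a, b, κ.third a u w} = ⊤) (g : G) :
    ∃ x : NormalForm, g = x.eval a b u w := by
  have hg : g ∈ Subgroup.closure {a, b, κ.third a u w} := hgen ▸ Subgroup.mem_top g
  induction hg using Subgroup.closure_induction_right with
  | one => exact ⟨⟨0, 0, false, false⟩, by simp [NormalForm.eval]⟩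
  | mul_right g _ s hs ih =>
    obtain ⟨x, rfl⟩ := ih
    rcases hs with rfl | rfl | rfl
    · exact ⟨_, (h.eval_step x .a).symm⟩
    · exact ⟨_, (h.eval_step x .b).symm⟩
    · exact ⟨_, (h.eval_step x .c).symm⟩
  | mul_inv_cancel g _ s hs ih =>
    obtain ⟨x, rfl⟩ := ih
    rcases hs with rfl | rfl | rfl
    · exact ⟨_, (h.eval_step x .A).symm⟩
    · exact ⟨_, (h.eval_step x .B).symm⟩
    · exact ⟨_, (h.eval_step x .C).symm⟩

theorem codes_take {q : ℕ} {n : ℕ} {L : List Letter} {x : NormalForm} (hn : n ∈ κ.codes q x L) :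
    ∃ i < L.length, ((L.take i).foldl κ.step x).code q = n := by
  induction L generalizing x with
  | nil => simp [codes] at hn
  | cons s L ih =>
    rcases List.mem_cons.1 hn with rfl | hn
    · exact ⟨0, by simp, rfl⟩
    · obtain ⟨i, hi, he⟩ := ih hn
      exact ⟨i + 1, by simpa using hi, by simpa using he⟩

theorem code_inj {q : ℕ} (hq : 0 < q) {x y : NormalForm} (h : x.code q = y.code q) :
    x.l % q = y.l % q ∧ x.i % 4 = y.i % 4 ∧ x.j = y.j ∧ x.k = y.k := by
  obtain ⟨l, i, j, k⟩ := x
  obtain ⟨l', i', j', k'⟩ := y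
  simp only [NormalForm.code] at h
  have h1 := Int.emod_nonneg l (b := q) (by omega)
  have h2 := Int.emod_nonneg l' (b := q) (by omega)
  have key : (l % q).toNat = (l' % q).toNat ∧ i % 4 = i' % 4 ∧ j = j' ∧ k = k' := by
    generalize (l % q).toNat = r at *
    generalize (l' % q).toNat = r' at *
    cases j <;> cases j' <;> cases k <;> cases k' <;> simp at h ⊢ <;> omega
  refine ⟨?_, key.2⟩
  dsimp only
  omega

theorem code_lt {q : ℕ} (hq : 0 < q) (x : NormalForm) : x.code q < 16 * q := by
  obtain ⟨l, i, j, k⟩ := x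
  have h1 := Int.emod_nonneg l (b := q) (by omega)
  have h2 := Int.emod_lt_of_pos l (b := q) (by omega)
  have h3 : (l % q).toNat < q := by omega
  simp only [NormalForm.code]
  generalize (l % q).toNat = r at *
  cases j <;> cases k <;> simp <;> omega

/-- The factor group lemma for `⟨w ^ K⟩`, `K` being the final exponent: the word meets all normal
forms modulo `u ^ 4` and `w ^ q`, hence all cosets once `w ^ q ∈ ⟨w ^ K⟩`. It is used with `q = 1`
when `w ^ K` generates `⟨w⟩`, and with `q = p` when `w ^ K = 1`. -/
theorem exists_isHamiltonianCycle_of_check [Finite G] [DecidableEq G] {S : Set G}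
    (h : κ.Realizes a b u w) (hgen : Subgroup.closure {a, b, κ.third a u w} = ⊤)
    (hS : {a, b, κ.third a u w} ⊆ S) {q : ℕ} (hq : 0 < q) {L : List Letter}
    (hL : κ.check q L = true) (hcard : Nat.card G = 16 * (orderOf (w ^ (κ.final L).l) * q))
    (hw : w ^ q ∈ Subgroup.zpowers (w ^ (κ.final L).l)) :
    ∃ (g : G) (c : (SimpleGraph.mulCayley S).Walk g g), c.IsHamiltonianCycle := by
  simp only [check, Bool.and_eq_true, beq_iff_eq, List.all_eq_true, List.mem_range,
    List.contains_iff_mem] at hL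
  obtain ⟨hlen, hfin, hcov⟩ := hL
  have hu4 : ∀ i j : ℤ, i % 4 = j % 4 → u ^ i = u ^ j := by
    intro i j hij
    rw [← zpow_mod_orderOf u i, ← zpow_mod_orderOf u j, h.orderOf_u]
    exact congrArg _ hij
  have hprod : ∀ M : List Letter, (M.map (Letter.val a b (κ.third a u w))).prod =
      (M.foldl κ.step ⟨0, 0, false, false⟩).eval a b u w := by
    intro M
    rw [h.eval_foldl]; simp [NormalForm.eval]
  have hx : (L.map (Letter.val a b (κ.third a u w))).prod = w ^ (κ.final L).l := by
    rw [hprod]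
    have := code_inj one_pos (x := κ.final L) (y := ⟨0, 0, false, false⟩) (by rw [hfin]; rfl)
    obtain ⟨-, hi, hj, hk⟩ := this
    change (κ.final L).eval a b u w = _
    rw [NormalForm.eval, hj, hk, hu4 _ 0 hi]
    simp
  refine List.exists_mulCayley_isHamiltonianCycle_of_coset
    (L := L.map (Letter.val a b (κ.third a u w))) ?_ ?_ ?_ ?_
  · intro s hs
    obtain ⟨y, -, rfl⟩ := List.mem_map.1 hs
    have ha : a ∈ S := hS (by simp)
    have hb : b ∈ S := hS (by simp)
    have hc : κ.third a u w ∈ S := hS (by simp)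
    cases y <;> simp [Letter.val, ha, hb, hc]
  · rw [hx, List.length_map, hlen, hcard]; ring
  · rw [hcard]
    have : 0 < orderOf (w ^ (κ.final L).l) * q := Nat.mul_pos (orderOf_pos _) hq
    omega
  · intro g
    obtain ⟨x, rfl⟩ := h.exists_eval hgen g
    obtain ⟨n, hn, he⟩ := codes_take (hcov _ (code_lt hq x))
    obtain ⟨hl, hi, hj, hk⟩ := code_inj hq he
    obtain ⟨d, hd⟩ : (q : ℤ) ∣ x.l - ((L.take n).foldl κ.step ⟨0, 0, false, false⟩).l :=
      Int.ModEq.dvd hl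
    obtain ⟨m, hm⟩ := Subgroup.mem_zpowers_iff.1 (zpow_mem hw d)
    refine ⟨m, n, by simpa using hn, ?_⟩
    rw [hx, ← List.map_take, hprod, hm]
    simp only [NormalForm.eval, hj, hk]
    rw [hu4 _ _ hi, ← zpow_natCast, ← zpow_mul, ← hd]
    simp only [← mul_assoc, ← zpow_add, sub_add_cancel]

theorem exists_isHamiltonianCycle [Finite G] [DecidableEq G] {S : Set G} {p : ℕ} (hp : p.Prime)
    (hp2 : p ≠ 2) (hcard : Nat.card G = 16 * p) (hw : orderOf w = p)
    (h : κ.Realizes a b u w) (hgen : Subgroup.closure {a, b, κ.third a u w} = ⊤)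
    (hS : {a, b, κ.third a u w} ⊆ S) (hκ : κ.admissible = true) :
    ∃ (g : G) (c : (SimpleGraph.mulCayley S).Walk g g), c.IsHamiltonianCycle := by
  have coprime : ∀ L, κ.check 1 L = true → ¬ p ∣ (κ.final L).l.natAbs →
      ∃ (g : G) (c : (SimpleGraph.mulCayley S).Walk g g), c.IsHamiltonianCycle := by
    intro L hL hK
    have hcop : p.Coprime (κ.final L).l.natAbs := (hp.coprime_iff_not_dvd).2 hK
    have ho : orderOf (w ^ (κ.final L).l) = p := by
      have : orderOf (w ^ (κ.final L).l.natAbs) = p := by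
        rw [Nat.Coprime.orderOf_pow (by rwa [hw]), hw]
      rcases Int.natAbs_eq (κ.final L).l with h' | h' <;> rw [h']
      · rw [zpow_natCast, this]
      · rw [zpow_neg, orderOf_inv, zpow_natCast, this]
    refine h.exists_isHamiltonianCycle_of_check hgen hS one_pos hL (by rw [hcard, ho, mul_one]) ?_
    have hle : Subgroup.zpowers (w ^ (κ.final L).l) ≤ Subgroup.zpowers w := by
      rw [Subgroup.zpowers_le]; exact zpow_mem (Subgroup.mem_zpowers w) _
    rw [Subgroup.eq_of_le_of_card_ge hle (by rw [Nat.card_zpowers, Nat.card_zpowers, hw, ho])]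
    simp
  have special : ∀ L, κ.check p L = true → (κ.final L).l % p = 0 →
      ∃ (g : G) (c : (SimpleGraph.mulCayley S).Walk g g), c.IsHamiltonianCycle := by
    intro L hL hK
    have h1 : w ^ (κ.final L).l = 1 := by
      rw [← orderOf_dvd_iff_zpow_eq_one, hw]; exact Int.dvd_of_emod_eq_zero hK
    refine h.exists_isHamiltonianCycle_of_check hgen hS hp.pos hL ?_ ?_
    · rw [h1, hcard]; simp
    · rw [← hw, pow_orderOf_eq_one]; exact one_mem _
  have hsol := solved_of_admissible κ hκ
  simp only [solved, Bool.or_eq_true, Bool.and_eq_true, List.any_eq_true, List.contains_iff_mem,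
    beq_iff_eq] at hsol
  have hdvd : ∀ k, k.Prime → p ∣ k → p = k := fun k hk hd ↦ (Nat.prime_dvd_prime_iff_eq hp hk).1 hd
  rcases hsol with (⟨L, -, hL, hK⟩ | ⟨hL, hK, hL', hK'⟩) | ⟨hL, hK, hL', hK'⟩
  · refine coprime L hL fun hd ↦ hp2 ?_
    have : (κ.final L).l.natAbs ∣ 2 ^ 4 := by
      simp only [List.mem_cons, List.not_mem_nil, or_false] at hK
      rcases hK with hK | hK | hK | hK | hK <;> rw [hK] <;> decide
    exact hdvd 2 Nat.prime_two (hp.dvd_of_dvd_pow (hd.trans this))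
  · by_cases h7 : p = 7
    · subst h7; exact special _ hL' hK'
    · exact coprime _ hL (by rw [hK]; exact fun hd ↦ h7 (hdvd 7 (by norm_num) hd))
  · by_cases h3 : p = 3
    · subst h3; exact special _ hL' hK'
    · refine coprime _ hL ?_
      rw [hK]
      intro hd
      rcases (hp.dvd_mul (m := 2) (n := 3)).1 hd with hd | hd
      · exact hp2 (hdvd 2 Nat.prime_two hd)
      · exact h3 (hdvd 3 Nat.prime_three hd)

end Params.Realizes

/-! ### The case where the third generator is `w` itself. -/

theorem List.exists_take_prod {M : Type*} [Monoid M] {L L₁ L₂ : List M} (h : L = L₁ ++ L₂)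
    (h₂ : L₂ ≠ []) : ∃ i < L.length, (L.take i).prod = L₁.prod := by
  subst h
  exact ⟨L₁.length, by simpa [List.length_pos_iff] using h₂, by simp⟩

theorem Params.Realizes.conj_w {G : Type*} [Group G] {κ : Params} {a b u w : G}
    (h : κ.Realizes a b u w) (hgen : Subgroup.closure {a, b, κ.third a u w} = ⊤) (g : G) :
    g⁻¹ * w * g = w ∨ g⁻¹ * w * g = w⁻¹ := by
  have pm : ∀ s, w ^ sgn s true = w ∨ w ^ sgn s true = w⁻¹ := by
    intro s; cases s <;> simp [sgn]
  have key : ∀ x y : G, (x⁻¹ * w * x = w ∨ x⁻¹ * w * x = w⁻¹) →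
      (y⁻¹ * w * y = w ∨ y⁻¹ * w * y = w⁻¹) →
      ((x * y)⁻¹ * w * (x * y) = w ∨ (x * y)⁻¹ * w * (x * y) = w⁻¹) := by
    intro x y hx hy
    have e : (x * y)⁻¹ * w * (x * y) = y⁻¹ * (x⁻¹ * w * x) * y := by group
    rw [e]
    rcases hx with hx | hx <;> rw [hx]
    · exact hy
    · have e : y⁻¹ * w⁻¹ * y = (y⁻¹ * w * y)⁻¹ := by group
      rw [e]
      rcases hy with hy | hy <;> simp [hy]
  have inv : ∀ x : G, (x * w * x⁻¹ = w ∨ x * w * x⁻¹ = w⁻¹) →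
      (x⁻¹ * w * x = w ∨ x⁻¹ * w * x = w⁻¹) := by
    rintro x (hx | hx)
    · left
      calc x⁻¹ * w * x = x⁻¹ * (x * w * x⁻¹) * x := by rw [hx]
        _ = w := by group
    · right
      calc x⁻¹ * w * x = (x⁻¹ * (w⁻¹) * x)⁻¹ := by group
        _ = (x⁻¹ * (x * w * x⁻¹) * x)⁻¹ := by rw [hx]
        _ = w⁻¹ := by group
  have ha := inv a (h.a_w ▸ pm _)
  have hb := inv b (h.b_w ▸ pm _)
  have hu : u⁻¹ * w * u = w := by rw [mul_assoc, ← h.u_w.eq]; group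
  have pow : ∀ x, (x⁻¹ * w * x = w ∨ x⁻¹ * w * x = w⁻¹) → ∀ j : Bool,
      ((if j then x else 1)⁻¹ * w * (if j then x else 1) = w ∨
        (if j then x else 1)⁻¹ * w * (if j then x else 1) = w⁻¹) := by
    intro x hx j; cases j <;> simp [hx]
  obtain ⟨⟨l, i, j, k⟩, rfl⟩ := h.exists_eval hgen g
  refine key _ _ (key _ _ (Or.inl ?_) (Or.inl ?_)) (key _ _ (pow a ha j) (pow b hb k))
  · dsimp only; group
  · have := (h.u_w.zpow_left i).eq
    rw [mul_assoc, ← this]; group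

/-- Thread the commutator word `a b a⁻¹ b⁻¹` through `⟨w⟩`: before each of its letters take `p - 1`
steps `w` or `w⁻¹`, sweeping a whole coset of `⟨w⟩`. The signs are chosen so that the powers of `w`
cancel and the product is `u`, of order 4; the length is `4 * p`. -/
theorem Params.Realizes.exists_isHamiltonianCycle_of_third_eq {G : Type*} [Group G] [Finite G]
    [DecidableEq G] {S : Set G} {κ : Params} {a b u w : G} {p : ℕ} (hp : p.Prime)
    (hcard : Nat.card G = 16 * p) (hw : orderOf w = p)
    (h : κ.Realizes a b u w) (hgen : Subgroup.closure {a, b, κ.third a u w} = ⊤)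
    (hS : {a, b, κ.third a u w} ⊆ S) (hthird : κ.third a u w = w) :
    ∃ (g : G) (c : (SimpleGraph.mulCayley S).Walk g g), c.IsHamiltonianCycle := by
  obtain ⟨n, rfl⟩ : ∃ n, p = n + 1 := ⟨p - 1, by have := hp.pos; omega⟩
  have conj := h.conj_w hgen
  rw [hthird] at hS
  have haS : a ∈ S := hS (by simp)
  have hbS : b ∈ S := hS (by simp)
  have hwS : w ∈ S := hS (by simp)
  have hpow : ∀ z : ℤ, ∃ r ≤ n, w ^ r = w ^ z := by
    intro z
    have h0 := Int.emod_nonneg z (b := ((n + 1 : ℕ) : ℤ)) (by omega)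
    have h1 := Int.emod_lt_of_pos z (b := ((n + 1 : ℕ) : ℤ)) (by omega)
    refine ⟨(z % ((n + 1 : ℕ) : ℤ)).toNat, by omega, ?_⟩
    rw [← zpow_natCast, Int.toNat_of_nonneg h0, ← hw, zpow_mod_orderOf]
  have hn : w ^ n = w⁻¹ := by
    rw [eq_inv_iff_mul_eq_one, ← pow_succ, ← hw, pow_orderOf_eq_one]
  -- Conjugates of `w` are `w` or `w⁻¹`, so `x`, `y`, `z` are legal steps; as conjugates, their
  -- powers move to the front of the prefix products whatever the signs are.
  obtain ⟨x, hx⟩ : ∃ x, x = a⁻¹ * w⁻¹ * a := ⟨_, rfl⟩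
  obtain ⟨y, hy⟩ : ∃ y, y = (a * b)⁻¹ * w * (a * b) := ⟨_, rfl⟩
  obtain ⟨z, hz⟩ : ∃ z, z = (a * b * a⁻¹)⁻¹ * w⁻¹ * (a * b * a⁻¹) := ⟨_, rfl⟩
  have conj' : ∀ g : G, g⁻¹ * w⁻¹ * g ∈ S ∨ (g⁻¹ * w⁻¹ * g)⁻¹ ∈ S := by
    intro g
    have e : g⁻¹ * w⁻¹ * g = (g⁻¹ * w * g)⁻¹ := by group
    rw [e]
    rcases conj g with h | h <;> simp [h, hwS]
  have hxr : ∀ r : ℕ, a * x ^ r = w⁻¹ ^ r * a := by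
    intro r
    have : x ^ r = a⁻¹ * w⁻¹ ^ r * a := by
      rw [hx]; simpa using conj_pow (a := a⁻¹) (b := w⁻¹) (i := r)
    rw [this]; group
  have hyr : ∀ r : ℕ, a * b * y ^ r = w ^ r * (a * b) := by
    intro r
    have : y ^ r = (a * b)⁻¹ * w ^ r * (a * b) := by
      rw [hy]; simpa using conj_pow (a := (a * b)⁻¹) (b := w) (i := r)
    rw [this]; group
  have hzr : ∀ r : ℕ, a * b * a⁻¹ * z ^ r = w⁻¹ ^ r * (a * b * a⁻¹) := by
    intro r
    have : z ^ r = (a * b * a⁻¹)⁻¹ * w⁻¹ ^ r * (a * b * a⁻¹) := by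
      rw [hz]; simpa using conj_pow (a := (a * b * a⁻¹)⁻¹) (b := w⁻¹) (i := r)
    rw [this]; group
  obtain ⟨L, hL⟩ : ∃ L : List G, L = List.replicate n w ++ a :: (List.replicate n x ++
      b :: (List.replicate n y ++ a⁻¹ :: (List.replicate n z ++ [b⁻¹]))) := ⟨_, rfl⟩
  have hu : a * b * a⁻¹ = u * b := by rw [h.comm]; group
  have p1 (r : ℕ) : w ^ n * (a * x ^ r) = w⁻¹ * w⁻¹ ^ r * a := by
    rw [hxr, hn, mul_assoc]
  have p2 (r : ℕ) : w ^ n * (a * (x ^ n * (b * y ^ r))) = w ^ r * (a * b) := by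
    rw [← mul_assoc a, hxr, mul_assoc _ a, ← mul_assoc a b, hyr, inv_pow, mul_inv_cancel_left]
  have p3 (r : ℕ) : w ^ n * (a * (x ^ n * (b * (y ^ n * (a⁻¹ * z ^ r))))) =
      w⁻¹ * w⁻¹ ^ r * (u * b) := by
    have e : w ^ n * (a * (x ^ n * (b * (y ^ n * (a⁻¹ * z ^ r))))) =
        w ^ n * (a * (x ^ n * (b * y ^ n))) * (a⁻¹ * z ^ r) := by simp only [mul_assoc]
    rw [e, p2, hn, mul_assoc, ← mul_assoc (a * b), hzr, hu, mul_assoc]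
  have hprod : L.prod = u := by
    have e : L.prod = w ^ n * (a * (x ^ n * (b * (y ^ n * (a⁻¹ * z ^ n))))) * b⁻¹ := by
      simp [hL, mul_assoc]
    rw [e, p3, inv_pow, hn]; group
  refine List.exists_mulCayley_isHamiltonianCycle_of_coset (L := L) ?_ ?_ (by omega) ?_
  · intro s hs
    simp only [hL, List.mem_append, List.mem_cons, List.mem_replicate, List.not_mem_nil,
      or_false] at hs
    rcases hs with ⟨-, rfl⟩ | rfl | ⟨-, rfl⟩ | rfl | ⟨-, rfl⟩ | rfl | ⟨-, rfl⟩ | rfl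
    · exact Or.inl hwS
    · exact Or.inl haS
    · exact hx ▸ conj' _
    · exact Or.inl hbS
    · rw [hy]
      rcases conj (a * b) with h | h <;> rw [h] <;> simp [hwS]
    · simp [haS]
    · exact hz ▸ conj' _
    · simp [hbS]
  · rw [hprod, h.orderOf_u, hcard]
    simp only [hL, List.length_append, List.length_cons, List.length_replicate, List.length_nil]
    ring
  · intro g
    suffices H : ∃ m : ℤ, ∃ L₁ L₂ : List G, L = L₁ ++ L₂ ∧ L₂ ≠ [] ∧ g = u ^ m * L₁.prod by
      obtain ⟨m, L₁, L₂, h₁, h₂, h₃⟩ := H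
      obtain ⟨i, hi, he⟩ := List.exists_take_prod h₁ h₂
      exact ⟨m, i, hi, by rw [hprod, he, h₃]⟩
    have split : ∀ (v : G) (r : ℕ), r ≤ n →
        List.replicate n v = List.replicate r v ++ List.replicate (n - r) v := by
      intro v r hr
      rw [List.replicate_append_replicate, Nat.add_sub_of_le hr]
    have huw : ∀ m n : ℤ, w ^ m * u ^ n = u ^ n * w ^ m := fun m n ↦ (h.u_w.zpow_zpow n m).eq.symm
    obtain ⟨⟨l, i, j, k⟩, rfl⟩ := h.exists_eval hgen g
    cases j <;> cases k
    · obtain ⟨r, hr, he⟩ := hpow l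
      refine ⟨i, List.replicate r w, List.replicate (n - r) w ++ a :: (List.replicate n x ++
        b :: (List.replicate n y ++ a⁻¹ :: (List.replicate n z ++ [b⁻¹]))), ?_, by simp, ?_⟩
      · rw [hL, ← List.append_assoc, ← split w r hr]
      · simp [NormalForm.eval, he, huw]
    -- This row runs through `w ^ (-1 - r) * (u * b)`, hence the choice of `r`; the extra `u` is
    -- absorbed by `i - 1`.
    · obtain ⟨r, hr, he⟩ := hpow (-1 - l)
      refine ⟨i - 1, List.replicate n w ++ a :: (List.replicate n x ++
        b :: (List.replicate n y ++ a⁻¹ :: List.replicate r z)),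
        List.replicate (n - r) z ++ [b⁻¹], ?_, by simp, ?_⟩
      · rw [hL, split z r hr]; simp only [List.append_assoc, List.cons_append]
      · simp only [List.prod_append, List.prod_cons, List.prod_replicate, p3, inv_pow, he]
        have e : w⁻¹ * (w ^ (-1 - l))⁻¹ = w ^ l := by group
        rw [e, ← mul_assoc (w ^ l) u]
        have := huw l 1
        rw [zpow_one] at this
        rw [this]
        simp only [NormalForm.eval, huw]
        simp [zpow_sub, mul_assoc]
    · obtain ⟨r, hr, he⟩ := hpow (-1 - l)
      refine ⟨i, List.replicate n w ++ a :: List.replicate r x, List.replicate (n - r) x ++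
        b :: (List.replicate n y ++ a⁻¹ :: (List.replicate n z ++ [b⁻¹])), ?_, by simp, ?_⟩
      · rw [hL, split x r hr]; simp only [List.append_assoc, List.cons_append]
      · simp only [List.prod_append, List.prod_cons, List.prod_replicate, p1, inv_pow, he]
        have e : w⁻¹ * (w ^ (-1 - l))⁻¹ = w ^ l := by group
        rw [e]
        simp [NormalForm.eval, huw, mul_assoc]
    · obtain ⟨r, hr, he⟩ := hpow l
      refine ⟨i, List.replicate n w ++ a :: (List.replicate n x ++ b :: List.replicate r y),
        List.replicate (n - r) y ++ a⁻¹ :: (List.replicate n z ++ [b⁻¹]), ?_, by simp, ?_⟩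
      · rw [hL, split y r hr]; simp only [List.append_assoc, List.cons_append]
      · simp only [List.prod_append, List.prod_cons, List.prod_replicate, p2, he]
        simp [NormalForm.eval, huw, mul_assoc]

/-! ### Derived subgroups of two-generator groups and the quotient of order 16. -/

open scoped commutatorElement

/-- Finiteness upgrades conjugation into `⟨u⟩` to conjugation onto it, so both generators lie in the
normalizer. -/
theorem Subgroup.normal_zpowers_of_closure_pair {G : Type*} [Group G] [Finite G] {a b u : G}
    (hgen : Subgroup.closure {a, b} = ⊤) (ha : a * u * a⁻¹ ∈ Subgroup.zpowers u)
    (hb : b * u * b⁻¹ ∈ Subgroup.zpowers u) : (Subgroup.zpowers u).Normal := by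
  have key : ∀ g : G, g * u * g⁻¹ ∈ Subgroup.zpowers u →
      g ∈ Subgroup.normalizer (Subgroup.zpowers u : Set G) := by
    intro g hg
    have hle : (Subgroup.zpowers u).map (MulAut.conj g).toMonoidHom ≤ Subgroup.zpowers u := by
      rw [MonoidHom.map_zpowers, Subgroup.zpowers_le]
      simpa using hg
    have heq : (Subgroup.zpowers u).map (MulAut.conj g).toMonoidHom = Subgroup.zpowers u := by
      refine Subgroup.eq_of_le_of_card_ge hle ?_
      rw [Subgroup.card_map_of_injective (MulAut.conj g).injective]
    rw [Subgroup.mem_normalizer_iff]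
    intro h
    constructor
    · intro hh
      exact hle ⟨h, hh, by simp⟩
    · intro hh
      rw [← heq] at hh
      obtain ⟨k, hk, he⟩ := hh
      have : k = h := by simpa using he
      exact this ▸ hk
  rw [← Subgroup.normalizer_eq_top_iff, eq_top_iff, ← hgen, Subgroup.closure_le]
  rintro g (rfl | rfl)
  · exact key _ ha
  · exact key _ hb

theorem commutator_le_of_closure_pair {G : Type*} [Group G] {a b : G} {N : Subgroup G} [N.Normal]
    (hgen : Subgroup.closure {a, b} = ⊤) (hN : ⁅a, b⁆ ∈ N) : commutator G ≤ N := by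
  have hab : Commute (a : G ⧸ N) (b : G ⧸ N) := by
    rw [← commutatorElement_eq_one_iff_commute]
    exact (QuotientGroup.eq_one_iff _).2 hN
  have cent : ∀ x : G ⧸ N, Commute x a → Commute x b → ∀ g : G, Commute x (g : G ⧸ N) := by
    intro x ha hb g
    have hg : g ∈ Subgroup.closure {a, b} := hgen ▸ Subgroup.mem_top g
    have hle : Subgroup.closure {a, b} ≤
        (Subgroup.centralizer {x}).comap (QuotientGroup.mk' N) := by
      rw [Subgroup.closure_le]
      rintro y (rfl | rfl) <;>
        simp only [SetLike.mem_coe, Subgroup.mem_comap, Subgroup.mem_centralizer_singleton_iff,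
          QuotientGroup.mk'_apply]
      · exact ha.eq.symm
      · exact hb.eq.symm
    exact (Subgroup.mem_centralizer_singleton_iff.1 (hle hg)).symm
  rw [commutator_def, Subgroup.commutator_le]
  intro g _ h _
  rw [← QuotientGroup.eq_one_iff]
  change ⁅(g : G ⧸ N), (h : G ⧸ N)⁆ = 1
  rw [commutatorElement_eq_one_iff_commute]
  exact (cent _ (cent _ (Commute.refl _) hab g).symm (cent _ hab.symm (Commute.refl _) g).symm h)

section Klein

variable {Q : Type*} [Group Q] {a b u : Q}

theorem mem_commutator_cases [Finite Q] (h4 : Nat.card (commutator Q) = 4) {u v : Q}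
    (hu : u ∈ commutator Q) (hv : v ∈ commutator Q) (hu1 : u ≠ 1) (hv1 : v ≠ 1) (huv : u ≠ v)
    (huv1 : u * v ≠ 1) {x : Q} (hx : x ∈ commutator Q) :
    x = 1 ∨ x = u ∨ x = v ∨ x = u * v := by
  classical
  have hsub : (({1, u, v, u * v} : Finset Q) : Set Q) ⊆ commutator Q := by
    intro y hy
    simp only [Finset.coe_insert, Finset.coe_singleton, Set.mem_insert_iff,
      Set.mem_singleton_iff] at hy
    rcases hy with rfl | rfl | rfl | rfl
    exacts [one_mem _, hu, hv, mul_mem hu hv]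
  have hcard : ({1, u, v, u * v} : Finset Q).card = 4 := by
    rw [Finset.card_insert_of_notMem, Finset.card_insert_of_notMem,
      Finset.card_insert_of_notMem] <;> simp [*, Ne.symm, eq_comm]
  have heq : (({1, u, v, u * v} : Finset Q) : Set Q) = commutator Q := by
    refine Set.eq_of_subset_of_ncard_le hsub ?_ (Set.toFinite _)
    rw [Set.ncard_coe_finset, hcard]
    exact h4.le
  have := heq ▸ (show x ∈ (commutator Q : Set Q) from hx)
  simpa using this

theorem commute_of_mem_commutator (h4 : Nat.card (commutator Q) = 4) {x y : Q}
    (hx : x ∈ commutator Q) (hy : y ∈ commutator Q) : x * y = y * x := by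
  have := Fact.mk Nat.prime_two
  have : Nat.card (commutator Q) = 2 ^ 2 := h4
  have := IsPGroup.isMulCommutative_of_card_eq_prime_sq this
  exact congrArg Subtype.val (mul_comm' (⟨x, hx⟩ : commutator Q) ⟨y, hy⟩)

/-- Otherwise `v = a * u * a⁻¹` gives `Q' = {1, u, v, u * v}`, and `b` centralises it: conjugating
`b * u = u * b` by `a` gives `b * v = v * b`. So `b` commutes with `a ^ 2 ∈ Q'`, while direct
computation gives `a ^ 2 * b = v * u * b * a ^ 2`; hence `v * u = 1` and `u = v`. -/
theorem conj_eq_of_fixed [Finite Q] (h4 : Nat.card (commutator Q) = 4) (hsq : ∀ x : Q, x * x ∈ commutator Q)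
    (hu : a * b = u * b * a) (huc : u ∈ commutator Q) (hu1 : u ≠ 1) (hu2 : u * u = 1)
    (hb : b * u = u * b) : a * u = u * a := by
  by_contra hne
  obtain ⟨v, hv⟩ : ∃ v, v = a * u * a⁻¹ := ⟨_, rfl⟩
  have hau : a * u = v * a := by rw [hv]; group
  have hvc : v ∈ commutator Q := hv ▸ Subgroup.Normal.conj_mem inferInstance _ huc _
  have huv : u ≠ v := by
    rintro rfl; exact hne hau
  have hui : u⁻¹ = u := inv_eq_of_mul_eq_one_left hu2
  have huv' := commute_of_mem_commutator h4 huc hvc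
  have hbv : b * v = v * b := by
    have h1 : (a * b * a⁻¹) * (a * u * a⁻¹) = (a * u * a⁻¹) * (a * b * a⁻¹) := by
      have : (a * b * a⁻¹) * (a * u * a⁻¹) = a * (b * u) * a⁻¹ := by group
      rw [this, hb]; group
    have h2 : a * b * a⁻¹ = u * b := by rw [hu]; group
    rw [h2, ← hv, mul_assoc, ← mul_assoc v, ← huv', mul_assoc] at h1
    exact mul_left_cancel h1
  have hcomm : b * (a * a) = a * a * b := by
    rcases mem_commutator_cases h4 huc hvc hu1
      (by rw [hv]; simpa using hu1) huv
      (fun h ↦ huv (by rw [← hui]; exact inv_eq_of_mul_eq_one_right h)) (hsq a)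
      with h | h | h | h <;> rw [h]
    · simp
    · exact hb
    · exact hbv
    · rw [← mul_assoc, hb, mul_assoc, hbv, mul_assoc]
  have h3 : a * a * b = v * u * b * (a * a) := by
    calc a * a * b = a * (a * b) := by group
      _ = (a * u) * b * a := by rw [hu]; group
      _ = v * (a * b) * a := by rw [hau]; group
      _ = v * u * b * (a * a) := by rw [hu]; group
  rw [← hcomm] at h3
  have h4 : v * u = 1 := by
    have : 1 * b * (a * a) = v * u * b * (a * a) := by rw [one_mul, h3]
    exact (mul_right_cancel (mul_right_cancel this)).symm
  exact huv (by rw [← hui]; exact inv_eq_of_mul_eq_one_left h4)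

/-- Suppose `u ^ 2 = 1`. A central `u` would force `Q' = ⟨u⟩`, which is too small, so by
`conj_eq_of_fixed` neither `a` nor `b` fixes `u`. The possible values of `b * u * b⁻¹` are then
excluded one by one. -/
theorem orderOf_commutatorElement_eq_four [Finite Q] (h4 : Nat.card (commutator Q) = 4)
    (hsq : ∀ x : Q, x * x ∈ commutator Q) (hgen : Subgroup.closure {a, b} = ⊤) :
    orderOf ⁅a, b⁆ = 4 := by
  obtain ⟨u, hu⟩ : ∃ u, u = ⁅a, b⁆ := ⟨_, rfl⟩
  rw [← hu]
  have huc : u ∈ commutator Q :=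
    hu ▸ Subgroup.commutator_mem_commutator (Subgroup.mem_top _) (Subgroup.mem_top _)
  have hab : a * b = u * b * a := by rw [hu, commutatorElement_def]; group
  have hdvd : orderOf u ∣ 4 := h4 ▸ Subgroup.orderOf_dvd_natCard _ huc
  have hcases : orderOf u = 4 ∨ orderOf u ∣ 2 := by
    have : orderOf u ≤ 4 := Nat.le_of_dvd (by norm_num) hdvd
    interval_cases orderOf u <;> simp_all
  refine hcases.resolve_right fun h2 ↦ ?_
  have hu2 : u * u = 1 := by rw [← pow_two]; exact orderOf_dvd_iff_pow_eq_one.1 h2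
  have hui : u⁻¹ = u := inv_eq_of_mul_eq_one_left hu2
  have notcentral : ¬ (a * u = u * a ∧ b * u = u * b) := by
    rintro ⟨ha, hb⟩
    have : (Subgroup.zpowers u).Normal := by
      refine Subgroup.normal_zpowers_of_closure_pair hgen ?_ ?_
      · rw [ha, mul_inv_cancel_right]; exact Subgroup.mem_zpowers u
      · rw [hb, mul_inv_cancel_right]; exact Subgroup.mem_zpowers u
    have hle := commutator_le_of_closure_pair (N := Subgroup.zpowers u) hgen
      (hu ▸ Subgroup.mem_zpowers u)
    have := Subgroup.card_le_of_le hle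
    rw [h4, Nat.card_zpowers] at this
    have := Nat.le_of_dvd (by norm_num) h2
    omega
  have hu1 : u ≠ 1 := fun h ↦ notcentral (by simp [h])
  have hbau : b * a = u * a * b := by
    rw [mul_assoc u, hab, mul_assoc u b, ← mul_assoc u u, hu2, one_mul]
  have case_b : b * u ≠ u * b := fun hb ↦
    notcentral ⟨conj_eq_of_fixed h4 hsq hab huc hu1 hu2 hb, hb⟩
  have case_a : a * u ≠ u * a := fun ha ↦
    notcentral ⟨ha, conj_eq_of_fixed h4 hsq hbau huc hu1 hu2 ha⟩
  obtain ⟨v, hv⟩ : ∃ v, v = a * u * a⁻¹ := ⟨_, rfl⟩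
  have hau : a * u = v * a := by rw [hv]; group
  have hvc : v ∈ commutator Q := hv ▸ Subgroup.Normal.conj_mem inferInstance _ huc _
  have huv : u ≠ v := by
    rintro rfl; exact case_a hau
  have huv' := commute_of_mem_commutator h4 huc hvc
  have sqc : ∀ x : Q, x * x * u = u * (x * x) := fun x ↦ commute_of_mem_commutator h4 (hsq x) huc
  have hcov := mem_commutator_cases h4 huc hvc hu1 (by rw [hv]; simpa using hu1) huv
      (fun h ↦ huv (by rw [← hui]; exact inv_eq_of_mul_eq_one_right h))
      (Subgroup.Normal.conj_mem inferInstance _ huc b)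
  have hbv : b * v = u * b := by
    rcases hcov with h | h | h | h
    · exact absurd h (by simpa using hu1)
    · exact absurd (by rw [mul_inv_eq_iff_eq_mul] at h; exact h) case_b
    · have hbu : b * u = v * b := by rw [← h]; group
      have e : b * (b * u) = u * (b * b) := by rw [← mul_assoc, sqc]
      rw [hbu, ← mul_assoc, ← mul_assoc] at e
      exact mul_right_cancel e
    -- Case `b * u * b⁻¹ = u * v`. Here `a` swaps `u` and `v`; since `Q'` is abelian, `a * b` and `b
    -- * a` act alike on it, so `b` sends `v` to `u * v` as well, forcing `u = v`.
    · exfalso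
      have hbu : b * u = u * v * b := by rw [← h]; group
      have hav : a * v = u * a := by
        have e : a * (a * u) = u * (a * a) := by rw [← mul_assoc, sqc]
        rw [hau, ← mul_assoc, ← mul_assoc] at e
        exact mul_right_cancel e
      have e1 : a * b * u = v * u * (a * b) := by
        rw [mul_assoc, hbu, ← mul_assoc, ← mul_assoc, hau, mul_assoc v a v, hav]
        simp only [mul_assoc]
      have e2 : a * b * u = u * (b * v) * a := by rw [hab, mul_assoc _ a u, hau]; group
      have e3 : b * v = v * u * b := by
        rw [e2, hab, ← huv'] at e1
        have : u * (b * v) * a = u * (u * v * b) * a := by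
          have : u * v * u = u * (u * v) := by rw [mul_assoc, ← huv']
          rw [e1, mul_assoc u b a, ← mul_assoc, this]
          simp only [mul_assoc]
        rw [← huv']
        exact mul_left_cancel (mul_right_cancel this)
      rw [← huv', ← hbu] at e3
      exact huv (mul_left_cancel e3).symm
  -- Now `a` and `b` both swap `u` and `v`, so `b * a` fixes `u`. As `⁅a, b * a⁆ = u`,
  -- `conj_eq_of_fixed` applies to the pair `a`, `b * a`.
  have hcomm : a * (b * a) = u * (b * a) * a := by rw [← mul_assoc, hab, mul_assoc u]
  have hfix : b * a * u = u * (b * a) := by rw [mul_assoc, hau, ← mul_assoc, hbv, mul_assoc]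
  exact case_a (conj_eq_of_fixed h4 hsq hcomm huc hu1 hu2 hfix)

end Klein

/-- In a finite nilpotent group a maximal subgroup is normal with cyclic quotient, so it contains
the derived subgroup: generation may be tested modulo `Q'`. -/
theorem eq_top_of_forall_commutator_le {Q : Type*} [Group Q] [Finite Q] [Group.IsNilpotent Q]
    {K : Subgroup Q} (h : ∀ M : Subgroup Q, K ≤ M → commutator Q ≤ M → M = ⊤) : K = ⊤ := by
  by_contra hK
  obtain ⟨M, hM, hle⟩ := (eq_top_or_exists_le_coatom K).resolve_left hK
  have hn : M.Normal :=
    Subgroup.NormalizerCondition.normal_of_coatom M Group.normalizerCondition_of_isNilpotent hM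
  obtain ⟨x, -, hx⟩ := SetLike.exists_of_lt hM.lt_top
  refine hM.1 (h M hle ?_)
  refine Subgroup.Normal.commutator_le_of_self_sup_commutative_eq_top (H := Subgroup.zpowers x)
    (hM.2 _ (lt_of_le_of_ne le_sup_left fun h ↦ hx ?_)) inferInstance
  rw [h]
  exact Subgroup.mem_sup_right (Subgroup.mem_zpowers x)

/-! ### Structure of the extension, and the case of two generators. -/

/-- A group `G` of order `16 * p` with a normal subgroup `N` of odd prime order `p` and
abelianization map `f` onto the Klein four-group. -/
structure IsKleinExtension {G : Type*} [Group G] (p : ℕ) (N : Subgroup G)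
    (f : G →* Multiplicative (ZMod 2) × Multiplicative (ZMod 2)) : Prop where
  prime : p.Prime
  ne_two : p ≠ 2
  card_eq : Nat.card G = 16 * p
  normal : N.Normal
  card_N : Nat.card N = p
  ker_f : f.ker = commutator G
  surj : Function.Surjective f

set_option synthInstance.maxSize 4000 in
theorem klein_four_cases : ∀ x y z : Multiplicative (ZMod 2) × Multiplicative (ZMod 2),
    x ≠ 1 → y ≠ 1 → x ≠ y → z = 1 ∨ z = x ∨ z = y ∨ z = x * y := by
  decide

theorem klein_four_mul_self : ∀ x : Multiplicative (ZMod 2) × Multiplicative (ZMod 2),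
    x * x = 1 := by
  decide

namespace IsKleinExtension

variable {G : Type*} [Group G] {p : ℕ} {N : Subgroup G}
  {f : G →* Multiplicative (ZMod 2) × Multiplicative (ZMod 2)}

theorem mem_commutator_iff (h : IsKleinExtension p N f) {g : G} : g ∈ commutator G ↔ f g = 1 := by
  rw [← h.ker_f, MonoidHom.mem_ker]

theorem mul_self_mem (h : IsKleinExtension p N f) (g : G) : g * g ∈ commutator G := by
  rw [h.mem_commutator_iff, map_mul, klein_four_mul_self]

theorem eq_one_of_pow (h : IsKleinExtension p N f) {n : G} (hn : n ∈ N) {k : ℕ}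
    (hk : n ^ 2 ^ k = 1) : n = 1 := by
  have h1 : orderOf n ∣ p := h.card_N ▸ Subgroup.orderOf_dvd_natCard N hn
  have h2 : orderOf n ∣ 2 ^ k := orderOf_dvd_of_pow_eq_one hk
  rcases (Nat.dvd_prime h.prime).1 h1 with h3 | h3
  · exact orderOf_eq_one_iff.1 h3
  · rw [h3] at h2
    exact absurd ((Nat.prime_dvd_prime_iff_eq h.prime Nat.prime_two).1
      (h.prime.dvd_of_dvd_pow h2)) h.ne_two

theorem orderOf_eq (h : IsKleinExtension p N f) {n : G} (hn : n ∈ N) (hn1 : n ≠ 1) :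
    orderOf n = p := by
  have h1 : orderOf n ∣ p := h.card_N ▸ Subgroup.orderOf_dvd_natCard N hn
  exact ((Nat.dvd_prime h.prime).1 h1).resolve_left fun h3 ↦ hn1 (orderOf_eq_one_iff.1 h3)

theorem finite (h : IsKleinExtension p N f) : Finite G :=
  Nat.finite_of_card_ne_zero (by rw [h.card_eq]; have := h.prime.pos; omega)

theorem zpowers_eq (h : IsKleinExtension p N f) {n : G} (hn : n ∈ N) (hn1 : n ≠ 1) :
    Subgroup.zpowers n = N := by
  have := h.finite
  refine Subgroup.eq_of_le_of_card_ge (by rwa [Subgroup.zpowers_le]) ?_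
  rw [h.card_N, Nat.card_zpowers, h.orderOf_eq hn hn1]

theorem le_commutator (h : IsKleinExtension p N f) : N ≤ commutator G := by
  intro n hn
  rw [h.mem_commutator_iff]
  by_cases hn1 : n = 1
  · simp [hn1]
  have h1 : n ^ p = 1 := h.orderOf_eq hn hn1 ▸ pow_orderOf_eq_one n
  obtain ⟨k, hk⟩ := h.prime.odd_of_ne_two h.ne_two
  have h2 : f n ^ p = 1 := by rw [← map_pow, h1, map_one]
  rwa [hk, pow_succ, pow_mul, pow_two, klein_four_mul_self, one_pow, one_mul] at h2

/-- The automorphism group of the cyclic group `N` is abelian, so the conjugation action kills `G'`.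
-/
theorem commute_of_mem (h : IsKleinExtension p N f) {g n : G} (hg : g ∈ commutator G)
    (hn : n ∈ N) : Commute g n := by
  have := h.normal
  have := Fact.mk h.prime
  have : IsCyclic N := isCyclic_of_prime_card h.card_N
  let φ : G →* (ZMod (Nat.card N))ˣ := (IsCyclic.mulAutMulEquiv N).toMonoidHom.comp MulAut.conjNormal
  have hφ : φ g = 1 := Abelianization.commutator_subset_ker φ hg
  have h1 : (MulAut.conjNormal g : MulAut N) = 1 := by
    have : IsCyclic.mulAutMulEquiv N (MulAut.conjNormal g) = 1 := hφ
    exact (map_eq_one_iff _ (IsCyclic.mulAutMulEquiv N).injective).1 this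
  have h2 := congrArg (fun e : MulAut N ↦ ((e ⟨n, hn⟩ : N) : G)) h1
  simp only [MulAut.conjNormal_apply, MulAut.one_apply] at h2
  exact mul_inv_eq_iff_eq_mul.1 h2

/-- Since `g ^ 2 ∈ G'` centralises `N`, `g` acts as `n ↦ n ^ k` with `k ^ 2 = 1` modulo `p`. -/
theorem conj_eq (h : IsKleinExtension p N f) (g : G) {n : G} (hn : n ∈ N) :
    g * n * g⁻¹ = n ∨ g * n * g⁻¹ = n⁻¹ := by
  by_cases hn1 : n = 1
  · simp [hn1]
  have hgn : g * n * g⁻¹ ∈ N := h.normal.conj_mem n hn g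
  rw [← h.zpowers_eq hn hn1, Subgroup.mem_zpowers_iff] at hgn
  obtain ⟨k, hk⟩ := hgn
  have h1 : g * (g * n * g⁻¹) * g⁻¹ = n := by
    have := (h.commute_of_mem (h.mul_self_mem g) hn).eq
    calc g * (g * n * g⁻¹) * g⁻¹ = g * g * n * (g * g)⁻¹ := by group
      _ = n := by rw [this]; group
  rw [← hk, ← conj_zpow, ← hk, ← zpow_mul] at h1
  have h2 : n ^ (k * k - 1) = 1 := by rw [zpow_sub_one, h1, mul_inv_cancel]
  have h3 : (p : ℤ) ∣ (k - 1) * (k + 1) := by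
    rw [← h.orderOf_eq hn hn1, orderOf_dvd_iff_zpow_eq_one, ← h2]; ring_nf
  rw [← hk]
  rcases (Nat.prime_iff_prime_int.1 h.prime).dvd_or_dvd h3 with h4 | h4 <;>
    rw [← h.orderOf_eq hn hn1, orderOf_dvd_iff_zpow_eq_one] at h4
  · left; rw [zpow_sub_one] at h4; exact (mul_inv_eq_one.1 h4)
  · right; rw [zpow_add_one] at h4; exact eq_inv_of_mul_eq_one_left h4

theorem card_commutator (h : IsKleinExtension p N f) : Nat.card (commutator G) = 4 * p := by
  have := h.finite
  have h1 := (commutator G).card_mul_index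
  have h2 : (commutator G).index = 4 := by
    rw [← h.ker_f, Subgroup.index_ker, MonoidHom.range_eq_top.2 h.surj, Subgroup.card_top]
    simp
  rw [h2, h.card_eq] at h1
  omega

section

variable (N) [N.Normal]

theorem commutator_quotient : commutator (G ⧸ N) = (commutator G).map (QuotientGroup.mk' N) := by
  rw [map_commutator_eq, commutator_def,
    MonoidHom.range_eq_top.2 (QuotientGroup.mk'_surjective N)]

end

theorem mem_commutator_quotient_iff (h : IsKleinExtension p N f) [N.Normal] {g : G} :
    (g : G ⧸ N) ∈ commutator (G ⧸ N) ↔ g ∈ commutator G := by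
  rw [commutator_quotient]
  refine ⟨?_, fun hg ↦ ⟨g, hg, rfl⟩⟩
  rintro ⟨x, hx, he⟩
  have : x⁻¹ * g ∈ N := QuotientGroup.eq.1 he
  have := mul_mem hx (h.le_commutator this)
  rwa [mul_inv_cancel_left] at this

theorem card_quotient (h : IsKleinExtension p N f) [N.Normal] : Nat.card (G ⧸ N) = 16 := by
  have := h.finite
  have h1 := N.card_eq_card_quotient_mul_card_subgroup
  rw [h.card_eq, h.card_N] at h1
  exact (Nat.eq_of_mul_eq_mul_right h.prime.pos h1).symm

theorem card_commutator_quotient (h : IsKleinExtension p N f) [N.Normal] :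
    Nat.card (commutator (G ⧸ N)) = 4 := by
  have := h.finite
  have h1 : (commutator (G ⧸ N)).index = 4 := by
    rw [← Subgroup.index_comap_of_surjective _ (QuotientGroup.mk'_surjective N)]
    have : (commutator (G ⧸ N)).comap (QuotientGroup.mk' N) = commutator G := by
      ext g; exact h.mem_commutator_quotient_iff
    rw [this, ← h.ker_f, Subgroup.index_ker, MonoidHom.range_eq_top.2 h.surj, Subgroup.card_top]
    simp
  have h2 := (commutator (G ⧸ N)).card_mul_index
  rw [h1, h.card_quotient] at h2
  omega

theorem mul_self_mem_quotient (h : IsKleinExtension p N f) [N.Normal] (x : G ⧸ N) :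
    x * x ∈ commutator (G ⧸ N) := by
  obtain ⟨g, rfl⟩ := QuotientGroup.mk_surjective x
  exact h.mem_commutator_quotient_iff.2 (h.mul_self_mem g)

theorem closure_quotient (h : IsKleinExtension p N f) [N.Normal] {a b : G} (ha : f a ≠ 1)
    (hb : f b ≠ 1) (hab : f a ≠ f b) :
    Subgroup.closure {(a : G ⧸ N), (b : G ⧸ N)} = ⊤ := by
  have := h.finite
  have := Fact.mk Nat.prime_two
  have : Group.IsNilpotent (G ⧸ N) :=
    (IsPGroup.of_card (p := 2) (n := 4) h.card_quotient).isNilpotent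
  refine eq_top_of_forall_commutator_le fun M hM hc ↦ ?_
  have haM : (a : G ⧸ N) ∈ M := hM (Subgroup.subset_closure (by simp))
  have hbM : (b : G ⧸ N) ∈ M := hM (Subgroup.subset_closure (by simp))
  rw [eq_top_iff]
  rintro x -
  obtain ⟨g, rfl⟩ := QuotientGroup.mk_surjective x
  have key : ∀ y : G, (y : G ⧸ N) ∈ M → f g = f y → (g : G ⧸ N) ∈ M := by
    intro y hy he
    have : ((y⁻¹ * g : G) : G ⧸ N) ∈ M := by
      refine hc (h.mem_commutator_quotient_iff.2 ?_)
      rw [h.mem_commutator_iff, map_mul, he, map_inv, inv_mul_cancel]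
    have := mul_mem hy this
    rwa [← QuotientGroup.mk_mul, mul_inv_cancel_left] at this
  rcases klein_four_cases _ _ (f g) ha hb hab with hg | hg | hg | hg
  · exact key 1 (one_mem M) (by simpa using hg)
  · exact key a haM hg
  · exact key b hbM hg
  · exact key (a * b) (mul_mem haM hbM) (by simpa using hg)

/-- `a` and `b` generate `G/N`, and `N` has prime order, so `⟨a, b⟩` either contains `N` or is a
complement of it. -/
theorem closure_eq_top_or (h : IsKleinExtension p N f) {a b : G} (ha : f a ≠ 1)
    (hb : f b ≠ 1) (hab : f a ≠ f b) :
    Subgroup.closure {a, b} ⊔ N = ⊤ ∧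
      (Subgroup.closure {a, b} = ⊤ ∨ ∀ n ∈ N, n ∈ Subgroup.closure {a, b} → n = 1) := by
  have := h.normal
  have h1 : Subgroup.closure {a, b} ⊔ N = ⊤ := by
    have h2 : (Subgroup.closure {a, b}).map (QuotientGroup.mk' N) = ⊤ := by
      rw [MonoidHom.map_closure, Set.image_pair]
      exact h.closure_quotient ha hb hab
    have h3 := congrArg (Subgroup.comap (QuotientGroup.mk' N)) h2
    rwa [Subgroup.comap_map_eq, QuotientGroup.ker_mk', Subgroup.comap_top] at h3
  refine ⟨h1, ?_⟩
  by_cases hn : ∀ n ∈ N, n ∈ Subgroup.closure {a, b} → n = 1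
  · exact Or.inr hn
  · push Not at hn
    obtain ⟨n, hnN, hnR, hn1⟩ := hn
    left
    have : N ≤ Subgroup.closure {a, b} := by
      rw [← h.zpowers_eq hnN hn1, Subgroup.zpowers_le]; exact hnR
    rwa [sup_eq_left.2 this] at h1

theorem orderOf_quotient (h : IsKleinExtension p N f) [N.Normal] {a b : G} (ha : f a ≠ 1)
    (hb : f b ≠ 1) (hab : f a ≠ f b) : orderOf ((⁅a, b⁆ : G) : G ⧸ N) = 4 := by
  have := h.finite
  exact orderOf_commutatorElement_eq_four h.card_commutator_quotient h.mul_self_mem_quotient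
    (h.closure_quotient ha hb hab)

theorem exists_zpow_quotient (h : IsKleinExtension p N f) [N.Normal] {a b : G} (ha : f a ≠ 1)
    (hb : f b ≠ 1) (hab : f a ≠ f b) {g : G} (hg : g ∈ commutator G) :
    ∃ m : Fin 4, (g : G ⧸ N) = ((⁅a, b⁆ ^ (m : ℤ) : G) : G ⧸ N) := by
  have := h.finite
  have ho := h.orderOf_quotient (N := N) ha hb hab
  have hle : Subgroup.zpowers ((⁅a, b⁆ : G) : G ⧸ N) = commutator (G ⧸ N) := by
    refine Subgroup.eq_of_le_of_card_ge ?_ ?_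
    · rw [Subgroup.zpowers_le, h.mem_commutator_quotient_iff]
      exact Subgroup.commutator_mem_commutator (Subgroup.mem_top _) (Subgroup.mem_top _)
    · rw [Nat.card_zpowers, h.card_commutator_quotient, ho]
  have hg' := h.mem_commutator_quotient_iff.2 hg
  rw [← hle, Subgroup.mem_zpowers_iff] at hg'
  obtain ⟨k, hk⟩ := hg'
  have h0 := Int.emod_nonneg k (b := 4) (by norm_num)
  have h1 := Int.emod_lt_of_pos k (b := 4) (by norm_num)
  refine ⟨⟨(k % 4).toNat, by omega⟩, ?_⟩
  rw [← hk, QuotientGroup.mk_zpow]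
  simp only [Int.toNat_of_nonneg h0]
  rw [← zpow_mod_orderOf, ho]
  rfl

theorem exists_isHamiltonianCycle_of_pair [DecidableEq G] (h : IsKleinExtension p N f) {a b : G}
    (ha : f a ≠ 1) (hb : f b ≠ 1) (hab : f a ≠ f b) (hgen : Subgroup.closure {a, b} = ⊤)
    {S : Set G} (haS : a ∈ S) (hbS : b ∈ S) :
    ∃ (g : G) (c : (SimpleGraph.mulCayley S).Walk g g), c.IsHamiltonianCycle := by
  have := h.finite
  have := h.normal
  have hp0 := h.prime.pos
  obtain ⟨u, hu⟩ : ∃ u, u = ⁅a, b⁆ := ⟨_, rfl⟩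
  have huc : u ∈ commutator G :=
    hu ▸ Subgroup.commutator_mem_commutator (Subgroup.mem_top _) (Subgroup.mem_top _)
  have h4 : 4 ∣ orderOf u := by
    have := orderOf_map_dvd (QuotientGroup.mk' N) u
    rw [QuotientGroup.mk'_apply, hu, h.orderOf_quotient ha hb hab] at this
    rwa [hu]
  have hdvd : orderOf u ∣ 4 * p := h.card_commutator ▸ Subgroup.orderOf_dvd_natCard _ huc
  -- If `u` had order 4, then `g * u * g⁻¹ = u ^ m * n` with `n ∈ N` would give `n ^ 4 = 1`, so `n =
  -- 1`. Then `⟨u⟩` would be normal and contain `G'`, whose order is `4 * p`.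
  have hne : orderOf u ≠ 4 := by
    intro ho
    have key : ∀ g : G, g * u * g⁻¹ ∈ Subgroup.zpowers u := by
      intro g
      have hgc : g * u * g⁻¹ ∈ commutator G := Subgroup.Normal.conj_mem inferInstance _ huc _
      obtain ⟨m, hm⟩ := h.exists_zpow_quotient (N := N) ha hb hab hgc
      rw [← hu] at hm
      have hn : (u ^ (m : ℤ))⁻¹ * (g * u * g⁻¹) ∈ N := QuotientGroup.eq.1 hm.symm
      obtain ⟨n, hn'⟩ : ∃ n, n = (u ^ (m : ℤ))⁻¹ * (g * u * g⁻¹) := ⟨_, rfl⟩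
      rw [← hn'] at hn
      have he : g * u * g⁻¹ = u ^ (m : ℤ) * n := by rw [hn']; group
      have hu4 : u ^ 4 = 1 := ho ▸ pow_orderOf_eq_one u
      have h1 : (g * u * g⁻¹) ^ 4 = 1 := by rw [conj_pow, hu4]; group
      rw [he, (h.commute_of_mem (zpow_mem huc _) hn).mul_pow, zpow_natCast u, ← pow_mul, mul_comm,
        pow_mul, hu4, one_pow, one_mul] at h1
      rw [he, h.eq_one_of_pow hn (k := 2) h1, mul_one]
      exact zpow_mem (Subgroup.mem_zpowers u) _
    have : (Subgroup.zpowers u).Normal :=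
      Subgroup.normal_zpowers_of_closure_pair hgen (key a) (key b)
    have hle := Subgroup.card_le_of_le
      (commutator_le_of_closure_pair (N := Subgroup.zpowers u) hgen
        (hu ▸ Subgroup.mem_zpowers u))
    rw [h.card_commutator, Nat.card_zpowers, ho] at hle
    have := h.prime.two_le
    omega
  have ho : orderOf u = 4 * p := by
    obtain ⟨d, hd⟩ := h4
    rw [hd] at hdvd hne ⊢
    have : d ∣ p := Nat.dvd_of_mul_dvd_mul_left (by norm_num) hdvd
    rcases (Nat.dvd_prime h.prime).1 this with rfl | rfl
    · exact absurd rfl hne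
    · rfl
  have hz : Subgroup.zpowers u = commutator G := by
    refine Subgroup.eq_of_le_of_card_ge (by rwa [Subgroup.zpowers_le]) ?_
    rw [Nat.card_zpowers, h.card_commutator, ho]
  have hprod : [a, b, a⁻¹, b⁻¹].prod = u := by
    simp [hu, commutatorElement_def, mul_assoc]
  refine List.exists_mulCayley_isHamiltonianCycle_of_coset (L := [a, b, a⁻¹, b⁻¹]) ?_ ?_ ?_ ?_
  · simp [haS, hbS]
  · rw [hprod, ho, h.card_eq]; simp; ring
  · rw [h.card_eq]; omega
  · intro g
    have key : ∀ i < 4, f g = f ([a, b, a⁻¹, b⁻¹].take i).prod →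
        ∃ m : ℤ, ∃ i < [a, b, a⁻¹, b⁻¹].length,
          g = [a, b, a⁻¹, b⁻¹].prod ^ m * ([a, b, a⁻¹, b⁻¹].take i).prod := by
      intro i hi he
      have : g * (([a, b, a⁻¹, b⁻¹].take i).prod)⁻¹ ∈ commutator G := by
        rw [h.mem_commutator_iff, map_mul, he, map_inv, mul_inv_cancel]
      rw [← hz, Subgroup.mem_zpowers_iff] at this
      obtain ⟨m, hm⟩ := this
      exact ⟨m, i, hi, by rw [hprod, hm, inv_mul_cancel_right]⟩
    rcases klein_four_cases _ _ (f g) ha hb hab with hg | hg | hg | hg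
    · exact key 0 (by norm_num) (by simpa using hg)
    · exact key 1 (by norm_num) (by simpa using hg)
    · exact key 3 (by norm_num) (by simp [hg, mul_comm (f b)])
    · exact key 2 (by norm_num) (by simpa using hg)

end IsKleinExtension

/-! ### Structure constants of a complement, and the third generator. -/

theorem conj_eq_zpow_sgn {G : Type*} [Group G] {u g : G} (hu : orderOf u = 4) (m : Fin 4)
    (h : g * u * g⁻¹ = u ^ (m : ℤ)) : ∃ s, g * u * g⁻¹ = u ^ sgn s true := by
  have hu4 : u ^ 4 = 1 := hu ▸ pow_orderOf_eq_one u
  have hne : ∀ k, 0 < k → k < 4 → u ^ k ≠ 1 := fun k h0 h4 ↦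
    pow_ne_one_of_lt_orderOf h0.ne' (by omega)
  fin_cases m
  · exfalso
    refine hne 1 (by norm_num) (by norm_num) ?_
    have : g * u * g⁻¹ = 1 := by simpa using h
    rw [pow_one]
    simpa using this
  · exact ⟨false, by simpa [sgn] using h⟩
  · exfalso
    refine hne 2 (by norm_num) (by norm_num) ?_
    have h2 : g * u * g⁻¹ = u ^ 2 := by simpa using h
    have : (g * u * g⁻¹) ^ 2 = 1 := by rw [h2, ← pow_mul, hu4]
    rw [conj_pow] at this
    simpa using this
  · refine ⟨true, ?_⟩
    have h2 : g * u * g⁻¹ = u ^ 3 := by simpa using h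
    rw [h2]
    simp only [sgn, Bool.and_self, if_true, zpow_neg, zpow_one]
    rw [eq_inv_iff_mul_eq_one, ← pow_succ, hu4]

theorem Params.Realizes.admissible {G : Type*} [Group G] {κ : Params} {a b u w : G}
    (h : κ.Realizes a b u w)
    (he : (if κ.e then κ.ca && !κ.cb else (κ.ca || κ.cb) && κ.t != 0) = true) :
    κ.admissible = true := by
  have hmod : ∀ i j : ℤ, u ^ i = u ^ j → (i - j) % 4 = 0 := by
    intro i j hij
    rw [← Int.emod_emod_of_dvd _ (dvd_refl (4 : ℤ))]
    have h1 : u ^ (i - j) = 1 := by rw [zpow_sub, hij, mul_inv_cancel]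
    rw [← orderOf_dvd_iff_zpow_eq_one, h.orderOf_u] at h1
    push_cast at h1
    omega
  have conj : ∀ (g : G) (s : Bool) (m : ℤ), g * u * g⁻¹ = u ^ sgn s true →
      g * u ^ m * g⁻¹ = u ^ (sgn s true * m) := by
    intro g s m hg
    rw [zpow_mul, ← hg, conj_zpow]
  have h1 : u ^ (sgn κ.sa true * (κ.α : ℤ)) = u ^ (κ.α : ℤ) := by
    rw [← conj a _ _ h.a_u, ← h.a_sq]; group
  have h2 : u ^ (sgn κ.sb true * (κ.β : ℤ)) = u ^ (κ.β : ℤ) := by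
    rw [← conj b _ _ h.b_u, ← h.b_sq]; group
  have h3 : u ^ (sgn κ.sa true * (κ.β : ℤ)) = u ^ (1 + sgn κ.sb true + (κ.β : ℤ)) := by
    have e : a * b * a⁻¹ = u * b := by rw [h.comm]; group
    rw [← conj a _ _ h.a_u, ← h.b_sq, zpow_add, zpow_add, ← h.b_u, ← h.b_sq, zpow_one]
    calc a * (b * b) * a⁻¹ = (a * b * a⁻¹) * (a * b * a⁻¹) := by group
      _ = _ := by rw [e]; group
  have h4 : u ^ (sgn κ.sb true * (κ.α : ℤ)) = u ^ ((κ.α : ℤ) - 1 - sgn κ.sa true) := by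
    have e : b * a * b⁻¹ = u⁻¹ * a := by rw [h.b_mul_a]; group
    have e' : (κ.α : ℤ) - 1 - sgn κ.sa true = -1 + -(sgn κ.sa true) + κ.α := by ring
    rw [← conj b _ _ h.b_u, ← h.a_sq, e', zpow_add, zpow_add, zpow_neg _ (sgn _ _), ← h.a_u,
      ← h.a_sq]
    calc b * (a * a) * b⁻¹ = (b * a * b⁻¹) * (b * a * b⁻¹) := by group
      _ = _ := by rw [e]; group
  simp only [Params.admissible, Bool.and_eq_true, beq_iff_eq]
  exact ⟨hmod _ _ h1, hmod _ _ h2, hmod _ _ h3, hmod _ _ h4, he⟩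

namespace IsKleinExtension

variable {G : Type*} [Group G] {p : ℕ} {N : Subgroup G}
  {f : G →* Multiplicative (ZMod 2) × Multiplicative (ZMod 2)}

theorem exists_zpow (h : IsKleinExtension p N f) {a b g : G} (ha : f a ≠ 1)
    (hb : f b ≠ 1) (hab : f a ≠ f b) (hR : ∀ n ∈ N, n ∈ Subgroup.closure {a, b} → n = 1)
    (hg : f g = 1) (hgR : g ∈ Subgroup.closure {a, b}) : ∃ m : Fin 4, g = ⁅a, b⁆ ^ (m : ℤ) := by
  have := h.normal
  obtain ⟨m, hm⟩ := h.exists_zpow_quotient (N := N) ha hb hab (h.mem_commutator_iff.2 hg)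
  have haR : a ∈ Subgroup.closure {a, b} := Subgroup.subset_closure (by simp)
  have hbR : b ∈ Subgroup.closure {a, b} := Subgroup.subset_closure (by simp)
  have hu : ⁅a, b⁆ ∈ Subgroup.closure {a, b} :=
    mul_mem (mul_mem (mul_mem haR hbR) (inv_mem haR)) (inv_mem hbR)
  refine ⟨m, ?_⟩
  have := hR _ (QuotientGroup.eq.1 hm) (mul_mem (inv_mem hgR) (zpow_mem hu _))
  exact (inv_mul_eq_one.1 this)

/-- The relations do not involve `e` and `t`, which are left free until the third generator is
known. -/
theorem exists_realizes (h : IsKleinExtension p N f) {a b w : G} (ha : f a ≠ 1)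
    (hb : f b ≠ 1) (hab : f a ≠ f b) (hR : ∀ n ∈ N, n ∈ Subgroup.closure {a, b} → n = 1)
    (hw : w ∈ N) : ∃ (sa sb ca cb : Bool) (α β : Fin 4), ∀ (e : Bool) (t : Fin 4),
      Params.Realizes ⟨sa, sb, ca, cb, e, α, β, t⟩ a b ⁅a, b⁆ w := by
  have := h.normal
  obtain ⟨u, hu⟩ : ∃ u, u = ⁅a, b⁆ := ⟨_, rfl⟩
  have haR : a ∈ Subgroup.closure {a, b} := Subgroup.subset_closure (by simp)
  have hbR : b ∈ Subgroup.closure {a, b} := Subgroup.subset_closure (by simp)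
  have huR : u ∈ Subgroup.closure {a, b} :=
    hu ▸ mul_mem (mul_mem (mul_mem haR hbR) (inv_mem haR)) (inv_mem hbR)
  have huc : u ∈ commutator G :=
    hu ▸ Subgroup.commutator_mem_commutator (Subgroup.mem_top _) (Subgroup.mem_top _)
  have hfu : f u = 1 := h.mem_commutator_iff.1 huc
  have ho' := h.orderOf_quotient (N := N) ha hb hab
  rw [← hu] at ho'
  have ho : orderOf u = 4 := by
    refine Nat.dvd_antisymm (orderOf_dvd_of_pow_eq_one (hR _ ?_ (pow_mem huR 4))) ?_
    · rw [← QuotientGroup.eq_one_iff, QuotientGroup.mk_pow, ← ho', pow_orderOf_eq_one]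
    · rw [← ho']; exact orderOf_map_dvd (QuotientGroup.mk' N) u
  have ex : ∀ g, f g = 1 → g ∈ Subgroup.closure {a, b} → ∃ m : Fin 4, g = u ^ (m : ℤ) :=
    fun g h1 h2 ↦ hu ▸ h.exists_zpow ha hb hab hR h1 h2
  have exs : ∀ g ∈ Subgroup.closure {a, b}, ∃ s, g * u * g⁻¹ = u ^ sgn s true := by
    intro g hg
    obtain ⟨m, hm⟩ := ex (g * u * g⁻¹) (by simp [hfu])
      (mul_mem (mul_mem hg huR) (inv_mem hg))
    exact conj_eq_zpow_sgn ho m hm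
  have exw : ∀ g, ∃ s, g * w * g⁻¹ = w ^ sgn s true := by
    intro g
    rcases h.conj_eq g hw with h1 | h1
    · exact ⟨false, by simpa [sgn] using h1⟩
    · exact ⟨true, by simpa [sgn] using h1⟩
  obtain ⟨sa, hsa⟩ := exs a haR
  obtain ⟨sb, hsb⟩ := exs b hbR
  obtain ⟨ca, hca⟩ := exw a
  obtain ⟨cb, hcb⟩ := exw b
  obtain ⟨α, hα⟩ := ex (a * a) (by rw [map_mul, klein_four_mul_self]) (mul_mem haR haR)
  obtain ⟨β, hβ⟩ := ex (b * b) (by rw [map_mul, klein_four_mul_self]) (mul_mem hbR hbR)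
  refine ⟨sa, sb, ca, cb, α, β, fun e t ↦ ?_⟩
  rw [← hu]
  exact ⟨ho, by rw [hu, commutatorElement_def]; group, hsa, hsb, hca, hcb,
    h.commute_of_mem huc hw, hα, hβ⟩

/-- If `b` inverts `w`, then `⁅c, b⁆ = ⁅q, b⁆ * z` with `z` a conjugate of `w ^ (-2)` commuting with
`⁅q, b⁆`. Fourth powers of commutators lie in `N`, hence are trivial both in `R` and in `⟨b, c⟩`; so
`z ^ 4 = 1`, and `w = 1` as `p` is odd. -/
theorem conj_eq_self (h : IsKleinExtension p N f) {b c q w : G} (hw : w ∈ N) (hcq : c = q * w)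
    (hR : ∃ R : Subgroup G, b ∈ R ∧ q ∈ R ∧ ∀ n ∈ N, n ∈ R → n = 1)
    (hK : ∀ n ∈ N, n ∈ Subgroup.closure {b, c} → n = 1) : b * w * b⁻¹ = w := by
  have := h.normal
  obtain ⟨R, hbR, hqR, hR⟩ := hR
  by_contra hne
  have hinv := (h.conj_eq b hw).resolve_left hne
  have hbK : b ∈ Subgroup.closure {b, c} := Subgroup.subset_closure (by simp)
  have hcK : c ∈ Subgroup.closure {b, c} := Subgroup.subset_closure (by simp)
  have hpow : ∀ x y : G, ⁅x, y⁆ ^ 4 ∈ N := by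
    intro x y
    rw [← QuotientGroup.eq_one_iff, QuotientGroup.mk_pow, ← orderOf_dvd_iff_pow_eq_one,
      ← h.card_commutator_quotient (N := N)]
    exact Subgroup.orderOf_dvd_natCard _ (h.mem_commutator_quotient_iff.2
      (Subgroup.commutator_mem_commutator (Subgroup.mem_top _) (Subgroup.mem_top _)))
  have h1 : ⁅q, b⁆ ^ 4 = 1 := hR _ (hpow _ _)
    (pow_mem (mul_mem (mul_mem (mul_mem hqR hbR) (inv_mem hqR)) (inv_mem hbR)) _)
  have h2 : ⁅c, b⁆ ^ 4 = 1 := hK _ (hpow _ _)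
    (pow_mem (mul_mem (mul_mem (mul_mem hcK hbK) (inv_mem hcK)) (inv_mem hbK)) _)
  obtain ⟨z, hz⟩ : ∃ z, z = (q * b) * (w ^ 2)⁻¹ * (q * b)⁻¹ := ⟨_, rfl⟩
  have hzN : z ∈ N := hz ▸ h.normal.conj_mem _ (inv_mem (pow_mem hw 2)) _
  have hwb : w * b = b * w⁻¹ := by
    have : b * w⁻¹ * b⁻¹ = w := by
      calc b * w⁻¹ * b⁻¹ = (b * w * b⁻¹)⁻¹ := by group
        _ = w := by rw [hinv, inv_inv]
    calc w * b = (b * w⁻¹ * b⁻¹) * b := by rw [this]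
      _ = b * w⁻¹ := by group
  have h3 : ⁅c, b⁆ = ⁅q, b⁆ * z := by
    have hcomm : Commute ⁅q, b⁆ z := h.commute_of_mem
      (Subgroup.commutator_mem_commutator (Subgroup.mem_top _) (Subgroup.mem_top _)) hzN
    rw [hcomm.eq, hz, hcq, commutatorElement_def, commutatorElement_def]
    calc q * w * b * (q * w)⁻¹ * b⁻¹ = q * (w * b) * w⁻¹ * q⁻¹ * b⁻¹ := by group
      _ = _ := by rw [hwb]; group
  have hcomm : Commute ⁅q, b⁆ z := h.commute_of_mem
    (Subgroup.commutator_mem_commutator (Subgroup.mem_top _) (Subgroup.mem_top _)) hzN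
  rw [h3, hcomm.mul_pow, h1, one_mul] at h2
  have hz1 := h.eq_one_of_pow hzN (k := 2) h2
  have hw2 : w ^ 2 = 1 := by
    rwa [hz, conj_eq_one_iff, inv_eq_one] at hz1
  have hw1 := h.eq_one_of_pow hw (k := 1) (by simpa using hw2)
  exact hne (by simp [hw1])

/-- If `a` and `b` both centralised `w`, then `N` would be central and its complement `R` normal
with abelian quotient, giving `N ≤ G' ≤ R`. -/
theorem conj_ne (h : IsKleinExtension p N f) {R : Subgroup G} {a b w : G}
    (hRab : R = Subgroup.closure {a, b}) (hR : ∀ n ∈ N, n ∈ R → n = 1) (hw : w ∈ N) (hw1 : w ≠ 1)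
    (hgen : R ⊔ N = ⊤) (ha : a * w * a⁻¹ = w) : b * w * b⁻¹ ≠ w := by
  have := h.normal
  have := Fact.mk h.prime
  have : IsCyclic N := isCyclic_of_prime_card h.card_N
  intro hb
  have hcent : Subgroup.centralizer {w} = ⊤ := by
    rw [eq_top_iff, ← hgen, sup_le_iff, hRab, Subgroup.closure_le]
    refine ⟨?_, fun n hn ↦ ?_⟩
    · rintro x (rfl | rfl) <;>
        rw [SetLike.mem_coe, Subgroup.mem_centralizer_singleton_iff]
      · exact mul_inv_eq_iff_eq_mul.1 ha
      · exact mul_inv_eq_iff_eq_mul.1 hb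
    · rw [Subgroup.mem_centralizer_singleton_iff]
      exact (h.commute_of_mem (h.le_commutator hn) hw).eq
  have hcomm : ∀ n ∈ N, ∀ g : G, Commute g n := by
    intro n hn g
    rw [← h.zpowers_eq hw hw1, Subgroup.mem_zpowers_iff] at hn
    obtain ⟨k, rfl⟩ := hn
    have : g ∈ Subgroup.centralizer {w} := hcent ▸ Subgroup.mem_top g
    exact Commute.zpow_right (Subgroup.mem_centralizer_singleton_iff.1 this) k
  have hnorm : R.Normal := by
    rw [← Subgroup.normalizer_eq_top_iff, eq_top_iff, ← hgen, sup_le_iff]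
    refine ⟨Subgroup.le_normalizer, fun n hn ↦ ?_⟩
    rw [Subgroup.mem_normalizer_iff]
    intro g
    rw [← (hcomm n hn g).eq, mul_inv_cancel_right]
  have hle := Subgroup.Normal.commutator_le_of_self_sup_commutative_eq_top hgen
    (inferInstance : IsMulCommutative N)
  exact hw1 (hR w hw (hle (h.le_commutator hw)))

theorem exists_isHamiltonianCycle_of_triple [DecidableEq G] (h : IsKleinExtension p N f)
    {a b c : G} (ha : f a ≠ 1) (hb : f b ≠ 1) (hab : f a ≠ f b) (hne : a ≠ c)
    (hc : f c = 1 ∨ f c = f a ∨ f c = f a * f b)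
    (hR : ∀ n ∈ N, n ∈ Subgroup.closure {a, b} → n = 1) (hcR : c ∉ Subgroup.closure {a, b})
    {S : Set G} (hS : Minimal (fun T : Set G => Subgroup.closure T = ⊤) S)
    (haS : a ∈ S) (hbS : b ∈ S) (hcS : c ∈ S) :
    ∃ (g : G) (c : (SimpleGraph.mulCayley S).Walk g g), c.IsHamiltonianCycle := by
  have := h.finite
  have := h.normal
  obtain ⟨hsup, -⟩ := h.closure_eq_top_or ha hb hab
  have haR : a ∈ Subgroup.closure {a, b} := Subgroup.subset_closure (by simp)
  have hbR : b ∈ Subgroup.closure {a, b} := Subgroup.subset_closure (by simp)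
  obtain ⟨q, hq, w, hw, hqw⟩ : ∃ q ∈ Subgroup.closure {a, b}, ∃ w ∈ N, q * w = c := by
    rw [← Subgroup.mem_sup_of_normal_right, hsup]
    exact Subgroup.mem_top c
  have hw1 : w ≠ 1 := by
    rintro rfl
    exact hcR (by rwa [← hqw, mul_one])
  have hfw : f w = 1 := h.mem_commutator_iff.1 (h.le_commutator hw)
  have hfq : f q = f c := by rw [← hqw, map_mul, hfw, mul_one]
  have hgen : Subgroup.closure {a, b, c} = ⊤ := by
    have h1 : Subgroup.closure {a, b} ≤ Subgroup.closure {a, b, c} :=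
      Subgroup.closure_mono (by intro x; simp; tauto)
    have hcm : c ∈ Subgroup.closure {a, b, c} := Subgroup.subset_closure (by simp)
    have hwm : w ∈ Subgroup.closure {a, b, c} := by
      have := mul_mem (inv_mem (h1 hq)) hcm
      rwa [← hqw, inv_mul_cancel_left, hqw] at this
    rw [eq_top_iff, ← hsup, sup_le_iff, ← h.zpowers_eq hw hw1, Subgroup.zpowers_le]
    exact ⟨h1, hwm⟩
  have hSsub : {a, b, c} ⊆ S := by
    rintro x (rfl | rfl | rfl) <;> assumption
  have hnw := h.conj_ne rfl hR hw hw1 hsup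
  -- By minimality, two elements of `S` omitting a third cannot generate `G`.
  have hproper : ∀ x ∈ S, ∀ y ∈ S, ∀ z ∈ S, x ≠ y → x ≠ z → f y ≠ 1 → f z ≠ 1 → f y ≠ f z →
      ∀ n ∈ N, n ∈ Subgroup.closure {y, z} → n = 1 := by
    intro x hx y hy z hz hxy hxz h1 h2 h3
    refine (h.closure_eq_top_or h1 h2 h3).2.resolve_left fun htop ↦ ?_
    have hle : S ⊆ {y, z} := hS.2 htop (by rintro t (rfl | rfl) <;> assumption)
    have := hle hx
    simp [hxy, hxz] at this
  have hpow := h.orderOf_eq hw hw1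
  have hane : a ≠ b := fun e ↦ hab (by rw [e])
  have hbnec : b ≠ c := fun e ↦ hcR (e ▸ hbR)
  obtain ⟨sa, sb, ca, cb, α, β, hreal⟩ := h.exists_realizes ha hb hab hR hw
  rcases hc with hc | hc | hc
  · obtain ⟨t, ht⟩ := h.exists_zpow ha hb hab hR (hfq.trans hc) hq
    have hr := hreal false t
    have hthird : Params.third ⟨sa, sb, ca, cb, false, α, β, t⟩ a ⁅a, b⁆ w = c := by
      simp [Params.third, ← ht, hqw]
    by_cases ht0 : t = 0
    · refine hr.exists_isHamiltonianCycle_of_third_eq h.prime h.card_eq hpow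
        (by rwa [hthird]) (by rwa [hthird]) ?_
      simp [Params.third, ht0]
    · refine hr.exists_isHamiltonianCycle h.prime h.ne_two h.card_eq hpow
        (by rwa [hthird]) (by rwa [hthird]) (hr.admissible ?_)
      have haw := hr.a_w
      have hbw := hr.b_w
      cases ca <;> cases cb <;> simp [ht0]
      simp only [sgn, Bool.false_and, Bool.false_eq_true, if_false, zpow_one] at haw hbw
      exact hnw haw hbw
  · have hbw' : b * w * b⁻¹ = w := by
      refine h.conj_eq_self hw hqw.symm ⟨_, hbR, hq, hR⟩ ?_
      exact hproper a haS b hbS c hcS hane hne hb (by rwa [hc]) (by rw [hc]; exact hab.symm)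
    have haw' : a * w * a⁻¹ ≠ w := fun e ↦ hnw e hbw'
    obtain ⟨t, ht⟩ := h.exists_zpow (g := a⁻¹ * q) ha hb hab hR
      (by rw [map_mul, map_inv, hfq, hc, inv_mul_cancel]) (mul_mem (inv_mem haR) hq)
    have hr := hreal true t
    have hthird : Params.third ⟨sa, sb, ca, cb, true, α, β, t⟩ a ⁅a, b⁆ w = c := by
      simp [Params.third, ← ht, hqw]
    refine hr.exists_isHamiltonianCycle h.prime h.ne_two h.card_eq hpow
        (by rwa [hthird]) (by rwa [hthird]) (hr.admissible ?_)
    have haw := hr.a_w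
    have hbw := hr.b_w
    have hww : w⁻¹ ≠ w := fun e ↦ hw1 (h.eq_one_of_pow hw (k := 1) (by
      rw [pow_one, pow_two]; nth_rewrite 1 [← e]; exact inv_mul_cancel w))
    cases ca <;> cases cb <;> simp [sgn] at haw hbw ⊢
    · exact haw' haw
    · exact haw' haw
    · exact hww (hbw.symm.trans hbw')
  -- Here `c` pairs with either of `a`, `b` to generate the Klein group, so both centralise `w`,
  -- against `conj_ne`.
  · exfalso
    have hca : f c ≠ f a := by rw [hc]; simpa using hb
    have hcb : f c ≠ f b := by rw [hc]; simpa using ha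
    have hc1 : f c ≠ 1 := by
      rw [hc]
      intro e
      apply hab
      have := klein_four_mul_self (f b)
      exact mul_right_cancel (e.trans this.symm)
    have hbw' : b * w * b⁻¹ = w := h.conj_eq_self hw hqw.symm ⟨_, hbR, hq, hR⟩
      (hproper a haS b hbS c hcS hane hne hb hc1 hcb.symm)
    have haw' : a * w * a⁻¹ = w := h.conj_eq_self hw hqw.symm ⟨_, haR, hq, hR⟩
      (hproper b hbS a haS c hcS hane.symm hbnec ha hc1 hca.symm)
    exact hnw haw' hbw'

/-! ### Choice of the generators and conclusion. -/

theorem exists_isHamiltonianCycle [DecidableEq G] (h : IsKleinExtension p N f)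
    {S : Set G} (hS : Minimal (fun T : Set G => Subgroup.closure T = ⊤) S) :
    ∃ (g : G) (c : (SimpleGraph.mulCayley S).Walk g g), c.IsHamiltonianCycle := by
  have hgenS : Subgroup.closure S = ⊤ := hS.1
  have outside : ∀ M : Subgroup G, M ≠ ⊤ → ∃ s ∈ S, s ∉ M := by
    intro M hM
    by_contra! hcon
    exact hM (top_le_iff.1 (hgenS ▸ (Subgroup.closure_le M).2 hcon))
  have hcomap : ∀ V : Subgroup (Multiplicative (ZMod 2) × Multiplicative (ZMod 2)),
      V ≠ ⊤ → V.comap f ≠ ⊤ := by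
    intro V hV e
    apply hV
    rw [← Subgroup.map_comap_eq_self_of_surjective h.surj V, e,
      Subgroup.map_top_of_surjective _ h.surj]
  obtain ⟨a, haS, ha⟩ := outside (f.ker) (hcomap ⊥ bot_ne_top)
  rw [MonoidHom.mem_ker] at ha
  obtain ⟨b, hbS, hb⟩ := outside ((Subgroup.zpowers (f a)).comap f) (hcomap _ fun e ↦ by
    have h1 := congrArg (fun V : Subgroup (Multiplicative (ZMod 2) × Multiplicative (ZMod 2)) ↦
      Nat.card V) e
    have h2 : orderOf (f a) ∣ 2 :=
      orderOf_dvd_of_pow_eq_one (by rw [pow_two, klein_four_mul_self])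
    have h3 := Nat.le_of_dvd (by norm_num) h2
    simp only [Nat.card_zpowers, Subgroup.card_top] at h1
    rw [h1] at h3
    simp at h3)
  rw [Subgroup.mem_comap] at hb
  have hb1 : f b ≠ 1 := fun e ↦ hb (e ▸ one_mem _)
  have hab : f a ≠ f b := fun e ↦ hb (e ▸ Subgroup.mem_zpowers _)
  by_cases htop : Subgroup.closure {a, b} = ⊤
  · exact h.exists_isHamiltonianCycle_of_pair ha hb1 hab htop haS hbS
  have hR := (h.closure_eq_top_or ha hb1 hab).2.resolve_left htop
  obtain ⟨c, hcS, hcR⟩ := outside _ htop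
  have hac : a ≠ c := fun e ↦ hcR (e ▸ Subgroup.subset_closure (by simp))
  have hbc : b ≠ c := fun e ↦ hcR (e ▸ Subgroup.subset_closure (by simp))
  rcases klein_four_cases _ _ (f c) ha hb1 hab with hc | hc | hc | hc
  · exact h.exists_isHamiltonianCycle_of_triple ha hb1 hab hac (.inl hc) hR hcR hS haS hbS hcS
  · exact h.exists_isHamiltonianCycle_of_triple ha hb1 hab hac (.inr (.inl hc)) hR hcR hS
      haS hbS hcS
  -- Exchanging `a` and `b` reduces this to the case `f c = f a`.
  · rw [Set.pair_comm] at hR hcR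
    exact h.exists_isHamiltonianCycle_of_triple hb1 ha hab.symm hbc (.inr (.inl hc)) hR hcR hS
      hbS haS hcS
  · exact h.exists_isHamiltonianCycle_of_triple ha hb1 hab hac (.inr (.inr hc)) hR hcR hS
      haS hbS hcS

end IsKleinExtension

theorem mainTheorem3 {G : Type*} [Group G] [DecidableEq G] (p : ℕ) (hp : p.Prime) (hp2 : p ≠ 2)
    (hcard : Nat.card G = 16 * p)
    (hnormal : ∀ P : Sylow p G, (P : Subgroup G).Normal)
    (hab : Nonempty (G ⧸ commutator G ≃* Multiplicative (ZMod 2) × Multiplicative (ZMod 2)))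
    (S : Set G) (hS : Minimal (fun T : Set G => Subgroup.closure T = ⊤) S) :
    ∃ (g : G) (c : (SimpleGraph.mulCayley S).Walk g g), c.IsHamiltonianCycle := by
  have := Fact.mk hp
  have : Finite G := Nat.finite_of_card_ne_zero (by rw [hcard]; have := hp.pos; omega)
  obtain ⟨e⟩ := hab
  obtain ⟨P⟩ : Nonempty (Sylow p G) := inferInstance
  have hP : Nat.card P = p := by
    have h16 : (16 : ℕ).factorization p = 0 := by
      refine Nat.factorization_eq_zero_of_not_dvd fun hd ↦ hp2 ?_
      exact (Nat.prime_dvd_prime_iff_eq hp Nat.prime_two).1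
        (hp.dvd_of_dvd_pow (show p ∣ 2 ^ 4 from hd))
    rw [P.card_eq_multiplicity, hcard, Nat.factorization_mul (by norm_num) hp.ne_zero]
    simp [h16, hp.factorization]
  have hK : IsKleinExtension p (P : Subgroup G)
      (e.toMonoidHom.comp (QuotientGroup.mk' (commutator G))) :=
    { prime := hp
      ne_two := hp2
      card_eq := hcard
      normal := hnormal P
      card_N := hP
      ker_f := by ext g; simp
      surj := e.surjective.comp (QuotientGroup.mk'_surjective _) }
  exact hK.exists_isHamiltonianCycle hS
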